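/- **Market and fund.** Let $T>0$ and let $(W_t)_{t\in[0,T]}$ be a one-dimensional Wiener process with respect to a filtration $(\mathcal F_t)$ on a probability space $(\Omega,\mathcal F,\mathbb Q)$. Let $r,\mu\in\mathbb R$ with $\mu>r$, $\sigma>0$, $\gamma=(\mu-r)/\sigma>0$ and $\tilde Z_t=\exp\!\big(-(r+\tfrac12\gamma^2)t-\gamma W_t\big)$. Let $v_0>0$ (initial fund value), $m\in[0,1]$ (management fee), $\alpha\in(0,1]$ (performance fee) and $c\in[0,1]$ with $c<1+m$ (first-loss guarantee). If the terminal value of the fund is $v\ge 0$, the manager receives $$M(v)=\begin{cases}v_0(m-c), & v-mv_0<(1-c)v_0,\\ v-v_0, & (1-c)v_0\le v-mv_0<v_0,\\ mv_0+\alpha(v-(1+m)v_0), & v-mv_0\ge v_0.\end{cases}$$ Let $b>0$, $b\neq1$, and let $a\ge v_0(c-m)$ if $b<1$, $a>v_0(c-m)$ if $b>1$. Put $U_M(v)=\frac1{1-b}(M(v)+a)^{1-b}$. The fund's optimal terminal value $V_T^*$ is a maximizer of $\mathbb E[U_M(V)]$ over all $\mathcal F_T$-measurable $V\ge0$ with $\mathbb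 E[\tilde Z_TV]\le v_0$. **Cases.** Let $$H=\frac{(mv_0+a)^{1-b}-(v_0(m-c)+a)^{1-b}}{(1-b)(1+m)v_0},\qquad \kappa=(mv_0+a)^{-b},$$ with $\kappa=+\infty$ if $mv_0+a=0$. Case A: $H<\alpha\kappa$. Case B: $\alpha\kappa\le H\le\kappa$. Case C: $\kappa<H$. Put $L=(1+m-\alpha^{-1}m)v_0-\alpha^{-1}a$ and $I_3(x)=\alpha^{1/b-1}x^{-1/b}+L$. For $y>0$, $z>0$ define $v(y,z)$ as follows. * Case A: $v(y,z)=I_3(yz)\,\mathbf 1_{\{z\le s/y\}}$, where $s=\alpha(\alpha\theta+(m-\alpha(1+m))v_0+a)^{-b}$ and $\theta$ is the unique solution in $((1+m)v_0,\infty)$ of $(\alpha\theta+(m-\alpha(1+m))v_0+a)^{-b}(b\alpha\theta+(m-\alpha(1+m))v_0+a)=(v_0(m-c)+a)^{1-b}$. * Case B: $v(y,z)=I_3(yz)\,\mathbf 1_{\{z<\alpha\kappa/y\}}+(1+m)v_0\,\mathbf 1_{\{\alpha\kappa/y\le z\le s/y\}}$, where $s=H$. * Case C: $v(y,z)=I_3(yz)\,\mathbf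 1_{\{z<\alpha\kappa/y\}}+(1+m)v_0\,\mathbf 1_{\{\alpha\kappa/y\le z\le\kappa/y\}}+\big((yz)^{-1/b}+v_0-a\big)\mathbf 1_{\{\kappa/y<z\le s/y\}}$, where $s=(\theta-v_0+a)^{-b}$ and $\theta$ is the unique solution in $((1+m-c)v_0,(1+m)v_0)$ of $(\theta-v_0+a)^{-b}(b\theta-v_0+a)=(v_0(m-c)+a)^{1-b}$. **Constants.** Let $\Phi$ be the standard normal distribution function, $\Phi(+\infty)=1$, $$\xi_3=\exp\!\Big(\tfrac1b\big(r+\tfrac12\gamma^2\big)T+\tfrac1{2b^2}\gamma^2T\Big),\qquad \xi_4=\exp\!\Big(\tfrac2b\big(r+\tfrac12\gamma^2\big)T+\tfrac2{b^2}\gamma^2T\Big),$$ $d(x)=\dfrac{\log x-(r+\frac12\gamma^2)T}{\gamma\sqrt T}$ and $\Delta_k(d,d')=\Phi(d+k\gamma\sqrt T)-\Phi(d'+k\gamma\sqrt T)$. Given $y^*>0$, put $d_1=+\infty$ and * Case A: $d_2=d(y^*/s)$; * Case B: $d_2=d(y^*\alpha^{-1}(mv_0+a)^b)$, $d_3=d(y^*/s)$;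 * Case C: $d_2=d(y^*\alpha^{-1}(mv_0+a)^b)$, $d_3=d(y^*(mv_0+a)^b)$, $d_4=d(y^*/s)$. **Statement.** In each of the three cases the solution $\theta$ above (Cases A and C) exists and is unique, there is a unique $y^*>0$ with $\mathbb E[\tilde Z_Tv(y^*,\tilde Z_T)]=v_0$, the random variable $v(y^*,\tilde Z_T)$ is an optimal terminal value, and every optimal terminal value $V_T^*$ has finite first and second moments, given by: Case A: $$\mathbb E[V_T^*]=(y^*)^{-1/b}\alpha^{(1-b)/b}\xi_3\Delta_{-1/b}(d_1,d_2)+L\,\Delta_0(d_1,d_2),$$ $$\mathbb E[(V_T^*)^2]=\alpha^{(2-2b)/b}(y^*)^{-2/b}\xi_4\Delta_{-2/b}(d_1,d_2)+2\alpha^{(1-b)/b}(y^*)^{-1/b}L\,\xi_3\Delta_{-1/b}(d_1,d_2)+L^2\Delta_0(d_1,d_2).$$ Case B: $$\mathbb E[V_T^*]=(y^*)^{-1/b}\alpha^{(1-b)/b}\xi_3\Delta_{-1/b}(d_1,d_2)+L\,\Delta_0(d_1,d_2)+(1+m)v_0\Delta_0(d_2,d_3),$$ $$\begin{aligned}\mathbb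 E[(V_T^*)^2]={}&\alpha^{(2-2b)/b}(y^*)^{-2/b}\xi_4\Delta_{-2/b}(d_1,d_2)+2\alpha^{(1-b)/b}(y^*)^{-1/b}L\,\xi_3\Delta_{-1/b}(d_1,d_2)\\&+L^2\Delta_0(d_1,d_2)+(1+m)^2v_0^2\Delta_0(d_2,d_3).\end{aligned}$$ Case C: $$\begin{aligned}\mathbb E[V_T^*]={}&(y^*)^{-1/b}\alpha^{(1-b)/b}\xi_3\Delta_{-1/b}(d_1,d_2)+L\,\Delta_0(d_1,d_2)+(1+m)v_0\Delta_0(d_2,d_3)\\&+(y^*)^{-1/b}\xi_3\Delta_{-1/b}(d_3,d_4)+(v_0-a)\Delta_0(d_3,d_4),\end{aligned}$$ $$\begin{aligned}\mathbb E[(V_T^*)^2]={}&\alpha^{(2-2b)/b}(y^*)^{-2/b}\xi_4\Delta_{-2/b}(d_1,d_2)+2\alpha^{(1-b)/b}(y^*)^{-1/b}L\,\xi_3\Delta_{-1/b}(d_1,d_2)\\&+L^2\Delta_0(d_1,d_2)+(1+m)^2v_0^2\Delta_0(d_2,d_3)+(y^*)^{-2/b}\xi_4\Delta_{-2/b}(d_3,d_4)\\&+2(y^*)^{-1/b}(v_0-a)\xi_3\Delta_{-1/b}(d_3,d_4)+(v_0-a)^2\Delta_0(d_3,d_4).\end{aligned}$$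 Consequently $\operatorname{Var}(V_T^*)>0$, and the fund's Sharpe ratio, i.e. $(\mathbb E[R]-r)/\sqrt{\operatorname{Var}(R)}$ for the rate of return $R=(V_T^*-v_0)/v_0$, equals $$\frac{\mathbb E[V_T^*]-v_0(1+r)}{\sqrt{\mathbb E[(V_T^*)^2]-(\mathbb E[V_T^*])^2}}.$$ -/

import Mathlib

open MeasureTheory ProbabilityTheory Set
open scoped NNReal ENNReal

/-- `W` is a one-dimensional Wiener process on `[0, T]` with respect to the filtration `ℱ`
under `Q`. Only the values at times `t ≤ T` matter. -/
structure IsWienerOn {Ω : Type*} {mΩ : MeasurableSpace Ω} (T : ℝ≥0) (ℱ : Filtration ℝ≥0 mΩ)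
    (Q : Measure Ω) (W : ℝ≥0 → Ω → ℝ) : Prop where
  adapted : ∀ t ≤ T, Measurable[ℱ t] (W t)
  start_zero : ∀ᵐ ω ∂Q, W 0 ω = 0
  gaussian_increments : ∀ s t : ℝ≥0, s ≤ t → t ≤ T →
    HasLaw (fun ω => W t ω - W s ω) (gaussianReal 0 (t - s)) Q
  indep_increments : ∀ s t : ℝ≥0, s ≤ t → t ≤ T →
    Indep (MeasurableSpace.comap (fun ω => W t ω - W s ω) inferInstance) (ℱ s) Q
  continuous_paths : ∀ᵐ ω ∂Q, ContinuousOn (fun t => W t ω) (Icc 0 T)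

/-- Numerical data of the model: market (`r`, `μ`, `σ`, horizon `T`), initial capital `v₀`,
fee structure (`m`, `α`, `c`) and the manager's HARA parameters (`a`, `b`). -/
structure FundModel where
  r : ℝ
  μ : ℝ
  σ : ℝ
  T : ℝ≥0
  v₀ : ℝ
  m : ℝ
  α : ℝ
  c : ℝ
  a : ℝ
  b : ℝ

noncomputable section

namespace FundModel

/-- Standing assumptions on the numerical data. -/
structure Admissible (p : FundModel) : Prop where
  T_pos : 0 < p.T
  σ_pos : 0 < p.σ
  /-- positive risk premium, i.e. `γ > 0` -/
  r_lt_μ : p.r < p.μ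
  v₀_pos : 0 < p.v₀
  m_mem : p.m ∈ Icc (0 : ℝ) 1
  α_mem : p.α ∈ Ioc (0 : ℝ) 1
  c_mem : p.c ∈ Icc (0 : ℝ) 1
  /-- the first kink `(1 + m - c) v₀` of the payoff is positive -/
  c_lt : p.c < 1 + p.m
  b_pos : 0 < p.b
  b_ne_one : p.b ≠ 1
  a_ge : p.b < 1 → p.v₀ * (p.c - p.m) ≤ p.a
  a_gt : 1 < p.b → p.v₀ * (p.c - p.m) < p.a

variable (p : FundModel)

/-- Market price of risk. -/
def γ : ℝ := (p.μ - p.r) / p.σ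

/-- State price density process. -/
def Z {Ω : Type*} (W : ℝ≥0 → Ω → ℝ) (t : ℝ≥0) (ω : Ω) : ℝ :=
  Real.exp (-(p.r + p.γ ^ 2 / 2) * t - p.γ * W t ω)

/-- The manager's terminal wealth as a function of the fund's terminal value. -/
def managerPayoff (v : ℝ) : ℝ :=
  if v - p.m * p.v₀ < (1 - p.c) * p.v₀ then p.v₀ * (p.m - p.c)
  else if v - p.m * p.v₀ < p.v₀ then v - p.v₀
  else p.m * p.v₀ + p.α * (v - (1 + p.m) * p.v₀)

/-- The manager's HARA utility of her own wealth. -/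
def hara (x : ℝ) : ℝ := 1 / (1 - p.b) * (x + p.a) ^ (1 - p.b)

/-- The manager's utility as a function of the fund's terminal value (used for `v ≥ 0` only). -/
def utility (v : ℝ) : ℝ := p.hara (p.managerPayoff v)

/-! ### The terminal value problem -/

/-- The expectation `E[X⁺] - E[X⁻]` with values in `[-∞, ∞]`. -/
def extExpectation {Ω : Type*} {mΩ : MeasurableSpace Ω} (Q : Measure Ω) (X : Ω → ℝ) : EReal :=
  ((∫⁻ ω, ENNReal.ofReal (X ω) ∂Q : ℝ≥0∞) : EReal)
    - ((∫⁻ ω, ENNReal.ofReal (-X ω) ∂Q : ℝ≥0∞) : EReal)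

variable {Ω : Type*} {mΩ : MeasurableSpace Ω}

/-- `V` is a nonnegative terminal value, known at time `T`, with `E[Z_T V] ≤ v₀`. -/
structure IsFeasible (ℱ : Filtration ℝ≥0 mΩ) (Q : Measure Ω) (W : ℝ≥0 → Ω → ℝ)
    (V : Ω → ℝ) : Prop where
  measurable : Measurable[ℱ p.T] V
  nonneg : ∀ᵐ ω ∂Q, 0 ≤ V ω
  integrable : Integrable (fun ω => p.Z W p.T ω * V ω) Q
  budget : ∫ ω, p.Z W p.T ω * V ω ∂Q ≤ p.v₀

/-- `V` is an optimal terminal value of the fund: it maximizes the manager's expected utility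
over all feasible terminal values, and its expected utility is finite. -/
structure IsOptimal (ℱ : Filtration ℝ≥0 mΩ) (Q : Measure Ω) (W : ℝ≥0 → Ω → ℝ)
    (V : Ω → ℝ) : Prop where
  feasible : p.IsFeasible ℱ Q W V
  integrable : Integrable (fun ω => p.utility (V ω)) Q
  optimal : ∀ V' : Ω → ℝ, p.IsFeasible ℱ Q W V' →
    extExpectation Q (fun ω => p.utility (V' ω)) ≤ extExpectation Q (fun ω => p.utility (V ω))

/-- Sharpe ratio of the terminal value `V`, for the rate of return `(V - v₀) / v₀`. -/
def sharpeRatio (Q : Measure Ω) (V : Ω → ℝ) : ℝ :=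
  ((∫ ω, (V ω - p.v₀) / p.v₀ ∂Q) - p.r) / √(variance (fun ω => (V ω - p.v₀) / p.v₀) Q)

/-! ### The three cases -/

/-- The ratio `H` (slope from `(0, U(0))` to the second kink) which decides between the cases. -/
def H : ℝ :=
  ((p.m * p.v₀ + p.a) ^ (1 - p.b) - (p.v₀ * (p.m - p.c) + p.a) ^ (1 - p.b))
    / ((1 - p.b) * (1 + p.m) * p.v₀)

/-- The power `(m v₀ + a)^(-b)`. It is `+∞` in the degenerate situation `m v₀ + a = 0`, which the
case distinction below treats separately. -/
def κ : ℝ := (p.m * p.v₀ + p.a) ^ (-p.b)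

/-- `H < α (m v₀ + a)^(-b)`, where the right-hand side is `+∞` if `m v₀ + a = 0`. -/
def CaseA : Prop := p.m * p.v₀ + p.a = 0 ∨ p.H < p.α * p.κ

/-- `α (m v₀ + a)^(-b) ≤ H ≤ (m v₀ + a)^(-b)`. -/
def CaseB : Prop := p.m * p.v₀ + p.a ≠ 0 ∧ p.α * p.κ ≤ p.H ∧ p.H ≤ p.κ

/-- `(m v₀ + a)^(-b) < H`. -/
def CaseC : Prop := p.m * p.v₀ + p.a ≠ 0 ∧ p.κ < p.H

/-- `θ` is a solution of the tangency equation of Case A on `((1 + m) v₀, ∞)`. -/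
def IsThetaA (θ : ℝ) : Prop :=
  (1 + p.m) * p.v₀ < θ ∧
    (p.α * θ + (p.m - p.α * (1 + p.m)) * p.v₀ + p.a) ^ (-p.b)
        * (p.b * p.α * θ + (p.m - p.α * (1 + p.m)) * p.v₀ + p.a)
      = (p.v₀ * (p.m - p.c) + p.a) ^ (1 - p.b)

/-- `θ` is a solution of the tangency equation of Case C on `((1 + m - c) v₀, (1 + m) v₀)`. -/
def IsThetaC (θ : ℝ) : Prop :=
  (1 + p.m - p.c) * p.v₀ < θ ∧ θ < (1 + p.m) * p.v₀ ∧
    (θ - p.v₀ + p.a) ^ (-p.b) * (p.b * θ - p.v₀ + p.a)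
      = (p.v₀ * (p.m - p.c) + p.a) ^ (1 - p.b)

/-- The slope `s(θ)` in Case A. -/
def slopeA (θ : ℝ) : ℝ := p.α * (p.α * θ + (p.m - p.α * (1 + p.m)) * p.v₀ + p.a) ^ (-p.b)

/-- The slope `s(θ)` in Case C. -/
def slopeC (θ : ℝ) : ℝ := (θ - p.v₀ + p.a) ^ (-p.b)

/-- The constant `(1 + m - m/α) v₀ - a/α`. -/
def L : ℝ := (1 + p.m - p.α⁻¹ * p.m) * p.v₀ - p.α⁻¹ * p.a

/-- Explicit terminal value in Case A, as a function of `y` and of the state price density `z`. -/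
def valueA (θ y z : ℝ) : ℝ :=
  (Ioc 0 (p.slopeA θ / y)).indicator
    (fun z => p.α ^ (1 / p.b - 1) * (y * z) ^ (-1 / p.b) + p.L) z

/-- Explicit terminal value in Case B. -/
def valueB (y z : ℝ) : ℝ :=
  (Ioo 0 (p.α * p.κ / y)).indicator
      (fun z => p.α ^ (1 / p.b - 1) * (y * z) ^ (-1 / p.b) + p.L) z
    + (Icc (p.α * p.κ / y) (p.H / y)).indicator (fun _ => (1 + p.m) * p.v₀) z

/-- Explicit terminal value in Case C. -/
def valueC (θ y z : ℝ) : ℝ :=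
  (Ioo 0 (p.α * p.κ / y)).indicator
      (fun z => p.α ^ (1 / p.b - 1) * (y * z) ^ (-1 / p.b) + p.L) z
    + (Icc (p.α * p.κ / y) (p.κ / y)).indicator (fun _ => (1 + p.m) * p.v₀) z
    + (Ioc (p.κ / y) (p.slopeC θ / y)).indicator
      (fun z => (y * z) ^ (-1 / p.b) + p.v₀ - p.a) z

/-- `y > 0` solves the budget equation `E[Z_T v(y, Z_T)] = v₀` for the family `v` of explicit
terminal values. -/
def IsMultiplier (Q : Measure Ω) (W : ℝ≥0 → Ω → ℝ) (v : ℝ → ℝ → ℝ) (y : ℝ) : Prop :=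
  0 < y ∧ ∫ ω, p.Z W p.T ω * v y (p.Z W p.T ω) ∂Q = p.v₀

/-! ### Constants in the moment formulas -/

/-- Distribution function of the standard normal law, with `Φ(-∞) = 0` and `Φ(+∞) = 1`. -/
def Φ (x : EReal) : ℝ := (gaussianReal 0 1).real {u : ℝ | (u : EReal) ≤ x}

/-- `Φ(d + k γ √T) - Φ(d' + k γ √T)`. -/
def ΔΦ (d d' : EReal) (k : ℝ) : ℝ :=
  Φ (d + ((k * p.γ * √(p.T : ℝ) : ℝ) : EReal)) - Φ (d' + ((k * p.γ * √(p.T : ℝ) : ℝ) : EReal))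

def ξ₃ : ℝ :=
  Real.exp (p.b⁻¹ * (p.r + p.γ ^ 2 / 2) * p.T + 1 / 2 * (p.b⁻¹) ^ 2 * p.γ ^ 2 * p.T)

def ξ₄ : ℝ :=
  Real.exp (2 * p.b⁻¹ * (p.r + p.γ ^ 2 / 2) * p.T + 2 * (p.b⁻¹) ^ 2 * p.γ ^ 2 * p.T)

/-- `(log x - (r + γ²/2) T) / (γ √T)`. -/
def d (x : ℝ) : ℝ := (Real.log x - (p.r + p.γ ^ 2 / 2) * p.T) / (p.γ * √(p.T : ℝ))

/-- The value `d₁ = +∞` common to the three cases. -/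
def d₁ : EReal := ⊤

def d₂A (θ y : ℝ) : EReal := (p.d (y / p.slopeA θ) : ℝ)

def d₂B (y : ℝ) : EReal := (p.d (y * p.α⁻¹ * (p.m * p.v₀ + p.a) ^ p.b) : ℝ)

def d₃B (y : ℝ) : EReal := (p.d (y / p.H) : ℝ)

def d₂C (y : ℝ) : EReal := (p.d (y * p.α⁻¹ * (p.m * p.v₀ + p.a) ^ p.b) : ℝ)

def d₃C (y : ℝ) : EReal := (p.d (y * (p.m * p.v₀ + p.a) ^ p.b) : ℝ)

def d₄C (θ y : ℝ) : EReal := (p.d (y / p.slopeC θ) : ℝ)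

/-- The first two moments of `V` exist and equal `M₁` and `M₂`. -/
def HasMoments (Q : Measure Ω) (V : Ω → ℝ) (M₁ M₂ : ℝ) : Prop :=
  Integrable V Q ∧ Integrable (fun ω => V ω ^ 2) Q ∧
    ∫ ω, V ω ∂Q = M₁ ∧ ∫ ω, V ω ^ 2 ∂Q = M₂

end FundModel

end

/-! The problem decouples over states of the world. For a price `x > 0` let `g x` maximize `U v - x
* v` over `v ≥ 0`. If `V = g (y * Z_T)` exhausts the budget, then inserting any feasible `V'` into
the pointwise inequality at `x = y * Z_T` and integrating shows that `V` is optimal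
(`isOptimal_of_isBestResponse`). The maximizer is unique except at one price `s`, and the lognormal
`Z_T` has no atoms, so every optimizer equals `V` almost surely
(`IsOptimal.ae_eq_of_isBestResponse`). The multiplier `y` exists and is unique because the budget
function of `y` is continuous and injective, exceeds `v₀` near `0` and tends to `0` at infinity
(`existsUnique_multiplier`).

To find `g`, note that `U` is constant below the lower kink and concave above it. Its concave hull
replaces an initial stretch by a chord of slope `s` starting at `(0, U 0)`. Comparing `H` with the
right slope `α * κ` and the left slope `κ` at the upper kink decides whether the chord lands beyond
that kink (A), on it (B) or between the kinks (C). In A and C it is a tangent, and its point of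
contact `θ` is found by the intermediate value theorem and the monotonicity `tangentValue_lt`. For
`x > s` the best choice is `0`; for `x ≤ s` it solves the first-order condition on the concave part
(`IsBestResponse.of_concavification`).

The moments follow because `g` is piecewise of the form `A * x ^ (-1 / b) + D`, so only truncated
moments of a lognormal variable are needed (`hasExpectation_truncated`, `hasMoments_of_piecewise`).
-/

noncomputable section

/-! ### Power utility and its tangents -/

/-- Isoelastic utility with relative risk aversion `b`. -/
def isoelastic (b w : ℝ) : ℝ := 1 / (1 - b) * w ^ (1 - b)

/-- Strict concavity, reduced by scaling to Bernoulli's inequality at `1 + t = w / w₀`. For `b > 1`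
the point `w = 0` must be excluded: there `0 ^ (1 - b) = 0` replaces the true value `-∞`. -/
lemma isoelastic_lt_tangent {b w w₀ : ℝ} (hb : 0 < b) (hb1 : b ≠ 1) (hw₀ : 0 < w₀) (hw : 0 ≤ w)
    (hw' : 1 < b → 0 < w) (hne : w ≠ w₀) :
    isoelastic b w < isoelastic b w₀ + w₀ ^ (-b) * (w - w₀) := by
  unfold isoelastic
  obtain ⟨t, rfl⟩ : ∃ t, w = w₀ * (1 + t) := ⟨w / w₀ - 1, by field_simp; ring⟩
  have ht0 : 0 ≤ 1 + t := nonneg_of_mul_nonneg_right hw hw₀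
  have ht : t ≠ 0 := by rintro rfl; simp at hne
  have hpos : 0 < w₀ ^ (1 - b) := Real.rpow_pos_of_pos hw₀ _
  have h1 : w₀ ^ (-b) * (w₀ * (1 + t) - w₀) = w₀ ^ (1 - b) * t := by
    rw [show (1 - b) = -b + 1 by ring, Real.rpow_add_one hw₀.ne']; ring
  rw [Real.mul_rpow hw₀.le ht0, h1]
  have key : 1 / (1 - b) * (1 + t) ^ (1 - b) < 1 / (1 - b) + t := by
    rcases lt_or_gt_of_ne hb1 with h | h
    · have h0 : 0 < 1 - b := by linarith
      have := rpow_one_add_lt_one_add_mul_self (s := t) (by linarith) ht h0 (by linarith)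
      calc 1 / (1 - b) * (1 + t) ^ (1 - b) < 1 / (1 - b) * (1 + (1 - b) * t) := by gcongr
        _ = _ := by field_simp
    · have h0 : 1 - b < 0 := by linarith
      have hw := hw' h
      have ht1 : 0 < 1 + t := pos_of_mul_pos_right hw hw₀.le
      have hlog : Real.log (1 + t) < t := by
        have := Real.log_lt_sub_one_of_pos ht1 (by simpa using ht)
        linarith
      have h2 : 1 + (1 - b) * t < (1 + t) ^ (1 - b) := by
        rw [Real.rpow_def_of_pos ht1]
        have := Real.add_one_le_exp (Real.log (1 + t) * (1 - b))
        nlinarith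
      have h3 : 1 / (1 - b) < 0 := one_div_neg.2 h0
      calc 1 / (1 - b) * (1 + t) ^ (1 - b) < 1 / (1 - b) * (1 + (1 - b) * t) :=
            mul_lt_mul_of_neg_left h2 h3
        _ = _ := by field_simp
  calc _ = w₀ ^ (1 - b) * (1 / (1 - b) * (1 + t) ^ (1 - b)) := by ring
    _ < w₀ ^ (1 - b) * (1 / (1 - b) + t) := by gcongr
    _ = _ := by ring

/-- The value at `e` of the tangent to the isoelastic utility at `w`. -/
def tangentValue (b e w : ℝ) : ℝ := isoelastic b w - w ^ (-b) * (w - e)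

/-- The tangent at `w₂` passes above the graph at `w₁` and is flatter than the tangent at `w₁`, so
it stays above that tangent all the way left to `e`. -/
lemma tangentValue_lt {b e w₁ w₂ : ℝ} (hb : 0 < b) (hb1 : b ≠ 1) (h1 : 0 < w₁) (he : e ≤ w₁)
    (h12 : w₁ < w₂) : tangentValue b e w₁ < tangentValue b e w₂ := by
  have h := isoelastic_lt_tangent hb hb1 (h1.trans h12) h1.le (fun _ => h1) h12.ne
  have h2 : w₂ ^ (-b) ≤ w₁ ^ (-b) := Real.rpow_le_rpow_of_nonpos h1 h12.le (by linarith)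
  unfold tangentValue
  nlinarith [mul_nonneg (sub_nonneg.2 h2) (sub_nonneg.2 he)]

lemma continuousOn_tangentValue (b e : ℝ) : ContinuousOn (tangentValue b e) (Ioi 0) := by
  unfold tangentValue isoelastic
  refine ContinuousOn.sub (continuousOn_const.mul ?_) (ContinuousOn.mul ?_ (by fun_prop))
  all_goals exact continuousOn_id.rpow_const fun x hx => Or.inl (ne_of_gt hx)

lemma tangentValue_eq {b e w : ℝ} (hb1 : b ≠ 1) (hw : 0 < w) :
    tangentValue b e w = b / (1 - b) * w ^ (1 - b) + e * w ^ (-b) := by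
  have : 1 - b ≠ 0 := sub_ne_zero.2 hb1.symm
  unfold tangentValue isoelastic
  rw [show (1 - b) = -b + 1 by ring, Real.rpow_add_one hw.ne']
  rw [show -b + 1 = 1 - b by ring]
  field_simp
  ring

/-- In the degenerate case of zero minimal wealth the tangent value is negative near `0`. -/
lemma exists_tangentValue_neg {b e h : ℝ} (hb : 0 < b) (hb1 : b < 1) (he : e < 0) (hh : 0 < h) :
    ∃ w, 0 < w ∧ w < h ∧ tangentValue b e w < 0 := by
  have h1 : 0 < 1 - b := by linarith
  have hq : 0 < -e * (1 - b) / b := by have := neg_pos.2 he; positivity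
  -- After factoring out `w ^ (-b)`, negativity of the tangent value reads `b / (1 - b) * w < -e`;
  -- the halves make both bounds strict.
  refine ⟨min (h / 2) (-e * (1 - b) / b / 2), by positivity, ?_, ?_⟩
  · exact (min_le_left _ _).trans_lt (by linarith)
  · set w := min (h / 2) (-e * (1 - b) / b / 2) with hw
    have hw0 : 0 < w := by positivity
    have hw1 : w < -e * (1 - b) / b := (min_le_right _ _).trans_lt (by linarith)
    rw [tangentValue_eq hb1.ne hw0, show (1 - b) = -b + 1 by ring, Real.rpow_add_one hw0.ne']
    rw [show -b + 1 = 1 - b by ring]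
    have h2 : b / (1 - b) * w < -e := by
      rw [lt_div_iff₀ hb] at hw1
      rw [div_mul_eq_mul_div, div_lt_iff₀ h1]; linarith
    have h3 : 0 < w ^ (-b) := Real.rpow_pos_of_pos hw0 _
    nlinarith

/-- For `b < 1` the tangent value tends to `+∞`. For `b > 1` it tends to `0`, which exceeds the
negative utility of `B > 0`. -/
lemma eventually_lt_tangentValue {b e B : ℝ} (hb : 0 < b) (hb1 : b ≠ 1) (hB : 1 < b → 0 < B) :
    ∀ᶠ w in Filter.atTop, isoelastic b B < tangentValue b e w := by
  have hlim : Filter.Tendsto (fun w : ℝ => e * w ^ (-b)) Filter.atTop (nhds (e * 0)) :=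
    (tendsto_rpow_neg_atTop hb).const_mul e
  have heq : (fun w => b / (1 - b) * w ^ (1 - b) + e * w ^ (-b)) =ᶠ[Filter.atTop]
      tangentValue b e := by
    filter_upwards [Filter.eventually_gt_atTop 0] with w hw using (tangentValue_eq hb1 hw).symm
  rcases lt_or_gt_of_ne hb1 with h | h
  · have h1 : 0 < 1 - b := by linarith
    have := ((tendsto_rpow_atTop h1).const_mul_atTop (div_pos hb h1)).atTop_add hlim
    exact (this.congr' heq).eventually_gt_atTop _
  · have h1 : 0 < b - 1 := by linarith
    have h2 : Filter.Tendsto (fun w : ℝ => b / (1 - b) * w ^ (1 - b)) Filter.atTop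
        (nhds (b / (1 - b) * 0)) := by
      have := (tendsto_rpow_neg_atTop h1).const_mul (b / (1 - b))
      simpa using this
    have h3 := (h2.add hlim).congr' heq
    refine h3.eventually_const_lt ?_
    have h4 : 0 < B ^ (1 - b) := Real.rpow_pos_of_pos (hB h) _
    have h5 : 1 / (1 - b) < 0 := one_div_neg.2 (by linarith)
    have := mul_neg_of_neg_of_pos h5 h4
    simpa [isoelastic] using this

/-! ### Kinks of the payoff and optimality on the concave part of the utility -/

namespace FundModel

variable (p : FundModel)

/-- The lower kink of the manager's payoff. -/
def kink₁ : ℝ := (1 + p.m - p.c) * p.v₀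

/-- The upper kink of the manager's payoff. -/
def kink₂ : ℝ := (1 + p.m) * p.v₀

/-- Argument of the manager's utility at the upper kink. -/
def midWealth : ℝ := p.m * p.v₀ + p.a

/-- Argument of the manager's utility below the lower kink. -/
def minWealth : ℝ := p.v₀ * (p.m - p.c) + p.a

variable {p}

lemma Admissible.minWealth_nonneg (hp : p.Admissible) : 0 ≤ p.minWealth := by
  unfold minWealth
  rcases lt_or_gt_of_ne hp.b_ne_one with h | h
  · nlinarith [hp.a_ge h]
  · nlinarith [hp.a_gt h]

lemma Admissible.minWealth_pos (hp : p.Admissible) (h : 1 < p.b) : 0 < p.minWealth := by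
  unfold minWealth
  nlinarith [hp.a_gt h]

lemma midWealth_eq (p : FundModel) : p.midWealth = p.minWealth + p.c * p.v₀ := by
  unfold midWealth minWealth; ring

lemma kink₂_eq (p : FundModel) : p.kink₂ = p.kink₁ + p.c * p.v₀ := by
  unfold kink₁ kink₂; ring

lemma Admissible.minWealth_le (hp : p.Admissible) : p.minWealth ≤ p.midWealth := by
  rw [midWealth_eq]; nlinarith [hp.c_mem.1, hp.v₀_pos]

lemma Admissible.midWealth_nonneg (hp : p.Admissible) : 0 ≤ p.midWealth :=
  hp.minWealth_nonneg.trans hp.minWealth_le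

lemma Admissible.kink₁_pos (hp : p.Admissible) : 0 < p.kink₁ :=
  mul_pos (by linarith [hp.c_lt]) hp.v₀_pos

lemma Admissible.kink₁_le (hp : p.Admissible) : p.kink₁ ≤ p.kink₂ := by
  rw [kink₂_eq]; nlinarith [hp.c_mem.1, hp.v₀_pos]

lemma Admissible.kink₂_pos (hp : p.Admissible) : 0 < p.kink₂ := hp.kink₁_pos.trans_le hp.kink₁_le

lemma utility_of_lt {v : ℝ} (h : v < p.kink₁) : p.utility v = isoelastic p.b p.minWealth := by
  have : v - p.m * p.v₀ < (1 - p.c) * p.v₀ := by unfold kink₁ at h; linarith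
  simp only [utility, hara, managerPayoff, if_pos this, isoelastic, minWealth]

lemma utility_of_mid {v : ℝ} (h : p.kink₁ ≤ v) (h' : v < p.kink₂) :
    p.utility v = isoelastic p.b (p.midWealth + (v - p.kink₂)) := by
  have h1 : ¬ v - p.m * p.v₀ < (1 - p.c) * p.v₀ := by unfold kink₁ at h; linarith
  have h2 : v - p.m * p.v₀ < p.v₀ := by unfold kink₂ at h'; linarith
  simp only [utility, hara, managerPayoff, if_neg h1, if_pos h2, isoelastic, midWealth, kink₂]
  congr 2; ring

lemma Admissible.utility_of_ge (hp : p.Admissible) {v : ℝ} (h : p.kink₂ ≤ v) :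
    p.utility v = isoelastic p.b (p.midWealth + p.α * (v - p.kink₂)) := by
  have h0 := hp.kink₁_le.trans h
  have h1 : ¬ v - p.m * p.v₀ < (1 - p.c) * p.v₀ := by unfold kink₁ at h0; linarith
  have h2 : ¬ v - p.m * p.v₀ < p.v₀ := by unfold kink₂ at h; linarith
  simp only [utility, hara, managerPayoff, if_neg h1, if_neg h2, isoelastic, midWealth, kink₂]
  congr 2; ring

lemma Admissible.utility_kink₂ (hp : p.Admissible) :
    p.utility p.kink₂ = isoelastic p.b p.midWealth := by
  rw [hp.utility_of_ge le_rfl]; simp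

lemma Admissible.utility_zero (hp : p.Admissible) :
    p.utility 0 = isoelastic p.b p.minWealth := utility_of_lt hp.kink₁_pos

lemma measurable_utility (p : FundModel) : Measurable p.utility := by
  have : Measurable p.managerPayoff := by
    unfold managerPayoff
    refine Measurable.ite (measurableSet_lt (by fun_prop) (by fun_prop)) (by fun_prop) ?_
    exact Measurable.ite (measurableSet_lt (by fun_prop) (by fun_prop)) (by fun_prop) (by fun_prop)
  unfold utility hara
  fun_prop

/-- Above the upper kink the utility lies below its tangents. -/
lemma Admissible.utility_lt_top (hp : p.Admissible) {w v : ℝ} (hw : 0 < w)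
    (hv : p.kink₂ ≤ v) (hne : p.midWealth + p.α * (v - p.kink₂) ≠ w) :
    p.utility v < isoelastic p.b w + w ^ (-p.b) * (p.midWealth + p.α * (v - p.kink₂) - w) := by
  rw [hp.utility_of_ge hv]
  have h1 : 0 ≤ p.α * (v - p.kink₂) := mul_nonneg hp.α_mem.1.le (sub_nonneg.2 hv)
  refine isoelastic_lt_tangent hp.b_pos hp.b_ne_one hw ?_ ?_ hne
  · linarith [hp.midWealth_nonneg]
  · intro h; linarith [hp.minWealth_pos h, hp.minWealth_le]

/-- Between the kinks the utility lies below its tangents. -/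
lemma Admissible.utility_lt_mid (hp : p.Admissible) {w v : ℝ} (hw : 0 < w)
    (hv : p.kink₁ ≤ v) (hv' : v < p.kink₂) (hne : p.midWealth + (v - p.kink₂) ≠ w) :
    p.utility v < isoelastic p.b w + w ^ (-p.b) * (p.midWealth + (v - p.kink₂) - w) := by
  rw [utility_of_mid hv hv']
  have h1 : p.minWealth ≤ p.midWealth + (v - p.kink₂) := by
    rw [midWealth_eq, kink₂_eq]; linarith
  refine isoelastic_lt_tangent hp.b_pos hp.b_ne_one hw ?_ ?_ hne
  · linarith [hp.minWealth_nonneg]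
  · intro h; linarith [hp.minWealth_pos h]

lemma Admissible.midWealth_pos_of_mid (hp : p.Admissible) {v : ℝ}
    (hv : p.kink₁ ≤ v) (hv' : v < p.kink₂) : 0 < p.midWealth := by
  rw [midWealth_eq]
  rw [kink₂_eq] at hv'
  linarith [hp.minWealth_nonneg]

/-- The price `x` lies between the right and left slopes of the utility at the upper kink, so it is
a supergradient there. -/
lemma Admissible.opt_kink (hp : p.Admissible) {x v : ℝ} (hN : 0 < p.midWealth)
    (hx : p.α * p.midWealth ^ (-p.b) ≤ x) (hx' : x ≤ p.midWealth ^ (-p.b))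
    (hv : p.kink₁ ≤ v) (hne : v ≠ p.kink₂) :
    p.utility v - x * v < p.utility p.kink₂ - x * p.kink₂ := by
  rw [hp.utility_kink₂]
  rcases lt_or_gt_of_ne hne with h | h
  · have := hp.utility_lt_mid hN hv h (by linarith [sub_ne_zero.2 hne])
    nlinarith
  · have := hp.utility_lt_top hN h.le (by nlinarith [hp.α_mem.1])
    nlinarith

/-- The price is parametrized by the manager's wealth `w` at which the first-order condition on the
top branch holds. Below the upper kink the slope of the utility exceeds this price, so the kink
already beats every such `v`. -/
lemma Admissible.opt_top (hp : p.Admissible) {w v : ℝ} (hw : 0 < w) (hNw : p.midWealth ≤ w)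
    (hv : p.kink₁ ≤ v) (hne : v ≠ p.kink₂ + (w - p.midWealth) / p.α) :
    p.utility v - p.α * w ^ (-p.b) * v
      < p.utility (p.kink₂ + (w - p.midWealth) / p.α)
        - p.α * w ^ (-p.b) * (p.kink₂ + (w - p.midWealth) / p.α) := by
  have hα := hp.α_mem.1
  set g := p.kink₂ + (w - p.midWealth) / p.α with hg
  have hgk : p.kink₂ ≤ g := by
    have : 0 ≤ (w - p.midWealth) / p.α := div_nonneg (by linarith) hα.le
    linarith
  have hgw : p.midWealth + p.α * (g - p.kink₂) = w := by rw [hg]; field_simp; ring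
  have hUg : p.utility g = isoelastic p.b w := by rw [hp.utility_of_ge hgk, hgw]
  have htop : ∀ v, p.kink₂ ≤ v → v ≠ g → p.utility v - p.α * w ^ (-p.b) * v
      < p.utility g - p.α * w ^ (-p.b) * g := by
    intro v hv hne
    have h1 : p.midWealth + p.α * (v - p.kink₂) ≠ w := by
      rw [← hgw]; intro h; apply hne
      have : p.α * (v - g) = 0 := by linarith
      rcases mul_eq_zero.1 this with h | h <;> linarith
    have := hp.utility_lt_top hw hv h1
    rw [hUg]
    have e : p.midWealth + p.α * (v - p.kink₂) - w = p.α * (v - g) := by rw [← hgw]; ring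
    rw [e] at this
    linarith
  rcases le_or_gt p.kink₂ v with h | h
  · exact htop v h hne
  · have hN := hp.midWealth_pos_of_mid hv h
    have h1 : w ^ (-p.b) ≤ p.midWealth ^ (-p.b) :=
      Real.rpow_le_rpow_of_nonpos hN hNw (by linarith [hp.b_pos])
    have hm := hp.utility_lt_mid hN hv h (by linarith)
    have hk : p.utility p.kink₂ - p.α * w ^ (-p.b) * p.kink₂
      ≤ p.utility g - p.α * w ^ (-p.b) * g := by
      rcases eq_or_ne p.kink₂ g with e | e
      · rw [← e]
      · exact (htop _ le_rfl e).le
    rw [hp.utility_kink₂] at hk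
    have hw0 : 0 < w ^ (-p.b) := Real.rpow_pos_of_pos hw _
    have : p.α * w ^ (-p.b) ≤ p.midWealth ^ (-p.b) := by nlinarith [hp.α_mem.2]
    nlinarith

/-- The counterpart of `opt_top` on the middle branch: here the price exceeds every slope of the top
branch, since those are at most `α * midWealth ^ (-b)`. -/
lemma Admissible.opt_mid (hp : p.Admissible) {w v : ℝ} (hw : 0 < w) (hBw : p.minWealth ≤ w)
    (hNw : w < p.midWealth) (hv : p.kink₁ ≤ v) (hne : v ≠ p.kink₂ + (w - p.midWealth)) :
    p.utility v - w ^ (-p.b) * v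
      < p.utility (p.kink₂ + (w - p.midWealth))
        - w ^ (-p.b) * (p.kink₂ + (w - p.midWealth)) := by
  set g := p.kink₂ + (w - p.midWealth) with hg
  have hg1 : p.kink₁ ≤ g := by rw [hg, kink₂_eq, midWealth_eq]; linarith
  have hg2 : g < p.kink₂ := by linarith
  have hgw : p.midWealth + (g - p.kink₂) = w := by rw [hg]; ring
  have hUg : p.utility g = isoelastic p.b w := by rw [utility_of_mid hg1 hg2, hgw]
  rw [hUg]
  have hN : 0 < p.midWealth := hw.trans hNw
  rcases lt_or_ge v p.kink₂ with h | h
  · have := hp.utility_lt_mid hw hv h (by intro h; apply hne; linarith)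
    nlinarith
  · have h0 := isoelastic_lt_tangent hp.b_pos hp.b_ne_one hw hN.le (fun _ => hN) hNw.ne'
    have h1 : p.midWealth ^ (-p.b) ≤ w ^ (-p.b) :=
      Real.rpow_le_rpow_of_nonpos hw hNw.le (by linarith [hp.b_pos])
    have h2 : p.utility v ≤ isoelastic p.b p.midWealth
        + p.midWealth ^ (-p.b) * (p.α * (v - p.kink₂)) := by
      rcases h.eq_or_lt with h | h
      · rw [← h, hp.utility_kink₂]; simp
      · have := hp.utility_lt_top hN h.le (by nlinarith [hp.α_mem.1])
        linarith
    have h3 : 0 < p.midWealth ^ (-p.b) := Real.rpow_pos_of_pos hN _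
    have h4 : p.midWealth ^ (-p.b) * (p.α * (v - p.kink₂)) ≤ w ^ (-p.b) * (v - p.kink₂) := by
      have h5 : 0 ≤ v - p.kink₂ := by linarith
      calc _ = (p.midWealth ^ (-p.b) * p.α) * (v - p.kink₂) := by ring
        _ ≤ _ := by gcongr; nlinarith [hp.α_mem.2]
    have : g = p.kink₂ + (w - p.midWealth) := hg
    nlinarith

end FundModel

/-! ### Best responses and concavification -/

/-- `g x` maximizes `U v - x v` over `v ≥ 0`, uniquely unless `x = s`; it vanishes for `x > s`
and is of order `x ^ (-1/b)` near `0`. -/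
structure IsBestResponse (U g : ℝ → ℝ) (s b : ℝ) : Prop where
  measurable : Measurable g
  s_pos : 0 < s
  le : ∀ x v, 0 < x → 0 ≤ v → U v - x * v ≤ U (g x) - x * g x
  lt : ∀ x v, 0 < x → 0 ≤ v → x ≠ s → v ≠ g x → U v - x * v < U (g x) - x * g x
  nonneg : ∀ x, 0 < x → 0 ≤ g x
  eq_zero : ∀ x, s < x → g x = 0
  pos : 0 < g s
  growth : ∃ C, ∀ x, 0 < x → g x ≤ C * (1 + x ^ (-1 / b))
  tendsto : Filter.Tendsto g (nhdsWithin 0 (Ioi 0)) Filter.atTop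

/-- Concavification: best responses over `v ≥ k` extend to best responses over `v ≥ 0` if `U` is
constant on `[0, k)` and the chord from `0` to `g s` has slope `s`. -/
lemma IsBestResponse.of_concavification {U g : ℝ → ℝ} {s b k : ℝ} (hg : Measurable g)
    (hs : 0 < s) (hk : 0 < k) (hU : ∀ v, 0 ≤ v → v < k → U v = U 0)
    (hchord : U (g s) = U 0 + s * g s)
    (hzero : ∀ x, s < x → g x = 0) (hge : ∀ x, 0 < x → x ≤ s → k ≤ g x)
    (hopt : ∀ x v, 0 < x → x ≤ s → k ≤ v → v ≠ g x → U v - x * v < U (g x) - x * g x)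
    (hgrowth : ∃ C, ∀ x, 0 < x → g x ≤ C * (1 + x ^ (-1 / b)))
    (hlim : Filter.Tendsto g (nhdsWithin 0 (Ioi 0)) Filter.atTop) : IsBestResponse U g s b := by
  have hopt' : ∀ x v, 0 < x → x ≤ s → k ≤ v → U v - x * v ≤ U (g x) - x * g x := by
    intro x v hx hxs hv
    rcases eq_or_ne v (g x) with h | h
    · rw [h]
    · exact (hopt x v hx hxs hv h).le
  -- The chord dominates `U`: it passes through the graph at `g s`, which is optimal at price `s`
  -- among `v ≥ k`.
  have hull : ∀ v, 0 ≤ v → U v ≤ U 0 + s * v := by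
    intro v hv
    rcases lt_or_ge v k with h | h
    · rw [hU v hv h]; nlinarith
    · linarith [hopt' s v hs le_rfl h]
  have hgs : 0 < g s := hk.trans_le (hge s hs le_rfl)
  -- Testing `g x` against `g s` shows that for `x ≤ s` it does at least as well as the flat part,
  -- strictly better if `x < s`.
  have hlow : ∀ x, 0 < x → x ≤ s → U 0 + (s - x) * g s ≤ U (g x) - x * g x := by
    intro x hx hxs
    have := hopt' x (g s) hx hxs (hge s hs le_rfl)
    linarith
  refine ⟨hg, hs, ?_, ?_, ?_, hzero, hgs, hgrowth, hlim⟩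
  · intro x v hx hv
    rcases lt_or_ge s x with h | h
    · rw [hzero x h]; nlinarith [hull v hv]
    · rcases lt_or_ge v k with hvk | hvk
      · rw [hU v hv hvk]
        nlinarith [hlow x hx h, mul_nonneg (sub_nonneg.2 h) hgs.le, mul_nonneg hx.le hv]
      · exact hopt' x v hx h hvk
  · intro x v hx hv hxs hne
    rcases lt_or_ge s x with h | h
    · rw [hzero x h] at hne ⊢
      have : 0 < v := lt_of_le_of_ne hv hne.symm
      nlinarith [hull v hv, mul_pos (sub_pos.2 h) this]
    · have hlt : x < s := lt_of_le_of_ne h hxs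
      rcases lt_or_ge v k with hvk | hvk
      · rw [hU v hv hvk]
        nlinarith [hlow x hx h, mul_pos (sub_pos.2 hlt) hgs, mul_nonneg hx.le hv]
      · exact hopt x v hx h hvk hne
  · intro x hx
    rcases lt_or_ge s x with h | h
    · rw [hzero x h]
    · exact hk.le.trans (hge x hx h)

end

/-! ### The explicit terminal values are best responses -/

noncomputable section

lemma tendsto_rpow_nhdsGT_zero_of_eq {g : ℝ → ℝ} {A D t b : ℝ} (hA : 0 < A) (hb : 0 < b)
    (ht : 0 < t) (h : ∀ x, 0 < x → x < t → g x = A * x ^ (-1 / b) + D) :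
    Filter.Tendsto g (nhdsWithin 0 (Ioi 0)) Filter.atTop := by
  have h1 : Filter.Tendsto (fun x : ℝ => x⁻¹ ^ (1 / b)) (nhdsWithin 0 (Ioi 0)) Filter.atTop :=
    (tendsto_rpow_atTop (one_div_pos.2 hb)).comp tendsto_inv_nhdsGT_zero
  have h2 := Filter.tendsto_atTop_add_const_right _ D (h1.const_mul_atTop hA)
  refine h2.congr' ?_
  filter_upwards [Ioo_mem_nhdsGT ht] with x hx
  rw [h x hx.1 hx.2, Real.inv_rpow hx.1.le, ← Real.rpow_neg hx.1.le, neg_div]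

namespace FundModel

variable {p : FundModel}

lemma rpow_neg_inv_rpow {b x : ℝ} (hb : 0 < b) (hx : 0 < x) : (x ^ (-1 / b)) ^ (-b) = x := by
  rw [← Real.rpow_mul hx.le]; field_simp; simp

lemma rpow_rpow_neg_inv {b x : ℝ} (hb : 0 < b) (hx : 0 < x) : (x ^ (-b)) ^ (-1 / b) = x := by
  rw [← Real.rpow_mul hx.le]; field_simp; simp

lemma le_rpow_neg_inv {b w x : ℝ} (hb : 0 < b) (hw : 0 < w) (hx : 0 < x) (h : x ≤ w ^ (-b)) :
    w ≤ x ^ (-1 / b) := by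
  calc w = (w ^ (-b)) ^ (-1 / b) := (rpow_rpow_neg_inv hb hw).symm
    _ ≤ _ := Real.rpow_le_rpow_of_nonpos hx h
      (div_nonpos_of_nonpos_of_nonneg (by norm_num) hb.le)

lemma rpow_neg_inv_lt {b w x : ℝ} (hb : 0 < b) (hw : 0 < w) (h : w ^ (-b) < x) :
    x ^ (-1 / b) < w := by
  calc x ^ (-1 / b) < (w ^ (-b)) ^ (-1 / b) := Real.rpow_lt_rpow_of_neg
        (Real.rpow_pos_of_pos hw _) h (div_neg_of_neg_of_pos (by norm_num) hb)
    _ = w := rpow_rpow_neg_inv hb hw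

lemma Admissible.L_eq (hp : p.Admissible) : p.L = p.kink₂ - p.midWealth / p.α := by
  have := hp.α_mem.1.ne'
  unfold L kink₂ midWealth; field_simp; ring

/-- The optimal fund value above the upper kink in terms of the manager's optimal wealth. -/
lemma Admissible.top_eq (hp : p.Admissible) {x : ℝ} (hx : 0 < x) :
    p.α ^ (1 / p.b - 1) * x ^ (-1 / p.b) + p.L
      = p.kink₂ + ((x / p.α) ^ (-1 / p.b) - p.midWealth) / p.α := by
  have hα := hp.α_mem.1
  rw [hp.L_eq, Real.div_rpow hx.le hα.le, Real.rpow_sub_one hα.ne', neg_div,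
    Real.rpow_neg hα.le (1 / p.b)]
  have : p.α ^ (1 / p.b) ≠ 0 := (Real.rpow_pos_of_pos hα _).ne'
  field_simp
  ring

lemma Admissible.top_slope (hp : p.Admissible) {x : ℝ} (hx : 0 < x) :
    p.α * ((x / p.α) ^ (-1 / p.b)) ^ (-p.b) = x := by
  have hα := hp.α_mem.1
  rw [rpow_neg_inv_rpow hp.b_pos (div_pos hx hα)]; field_simp

/-- Strict optimality of the value above the upper kink for small `x`. -/
lemma Admissible.opt_top' (hp : p.Admissible) {x v : ℝ} (hx : 0 < x)
    (hN : p.midWealth ≤ (x / p.α) ^ (-1 / p.b)) (hv : p.kink₁ ≤ v)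
    (hne : v ≠ p.α ^ (1 / p.b - 1) * x ^ (-1 / p.b) + p.L) :
    p.utility v - x * v
      < p.utility (p.α ^ (1 / p.b - 1) * x ^ (-1 / p.b) + p.L)
        - x * (p.α ^ (1 / p.b - 1) * x ^ (-1 / p.b) + p.L) := by
  rw [hp.top_eq hx] at hne ⊢
  have := hp.opt_top (w := (x / p.α) ^ (-1 / p.b))
    (Real.rpow_pos_of_pos (div_pos hx hp.α_mem.1) _) hN hv hne
  rwa [hp.top_slope hx] at this

lemma Admissible.kink₂_le_top (hp : p.Admissible) {x : ℝ} (hx : 0 < x)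
    (hN : p.midWealth ≤ (x / p.α) ^ (-1 / p.b)) :
    p.kink₂ ≤ p.α ^ (1 / p.b - 1) * x ^ (-1 / p.b) + p.L := by
  rw [hp.top_eq hx]
  have : 0 ≤ ((x / p.α) ^ (-1 / p.b) - p.midWealth) / p.α :=
    div_nonneg (by linarith) hp.α_mem.1.le
  linarith

lemma Admissible.le_rpow_of_le_κ (hp : p.Admissible) {x : ℝ} (hx : 0 < x)
    (hN : 0 < p.midWealth) (h : x ≤ p.α * p.κ) : p.midWealth ≤ (x / p.α) ^ (-1 / p.b) := by
  refine le_rpow_neg_inv hp.b_pos hN (div_pos hx hp.α_mem.1) ?_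
  rw [div_le_iff₀ hp.α_mem.1, mul_comm]
  exact h

lemma top_le_growth {A D x b : ℝ} (hA : 0 ≤ A) (hx : 0 < x) :
    A * x ^ (-1 / b) + D ≤ (A + |D|) * (1 + x ^ (-1 / b)) := by
  have h := Real.rpow_nonneg hx.le (-1 / b)
  nlinarith [le_abs_self D, abs_nonneg D, mul_nonneg (abs_nonneg D) h]

/-- Identifies `H` as the slope of the chord from `(0, U 0)` to the upper kink. -/
lemma Admissible.H_eq (hp : p.Admissible) :
    p.H = (isoelastic p.b p.midWealth - isoelastic p.b p.minWealth) / p.kink₂ := by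
  have h1 : 1 - p.b ≠ 0 := sub_ne_zero.2 hp.b_ne_one.symm
  have hk := hp.kink₂_pos.ne'
  unfold H isoelastic
  rw [show p.m * p.v₀ + p.a = p.midWealth from rfl,
    show p.v₀ * (p.m - p.c) + p.a = p.minWealth from rfl,
    show (1 - p.b) * (1 + p.m) * p.v₀ = (1 - p.b) * p.kink₂ by unfold kink₂; ring]
  field_simp

/-! ### Case A -/

/-- The multiplier and the density enter only through their product, so the whole family comes from
the single function `valueA θ 1`. -/
lemma valueA_eq (θ : ℝ) {y : ℝ} (hy : 0 < y) (z : ℝ) :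
    p.valueA θ y z = p.valueA θ 1 (y * z) := by
  simp only [valueA, indicator, mem_Ioc, div_one, one_mul]
  simp only [le_div_iff₀ hy, mul_comm z y, mul_pos_iff_of_pos_left hy]

lemma valueA_of_le (θ : ℝ) {x : ℝ} (hx : 0 < x) (h : x ≤ p.slopeA θ) :
    p.valueA θ 1 x = p.α ^ (1 / p.b - 1) * x ^ (-1 / p.b) + p.L := by
  simp [valueA, hx, h]

lemma valueA_of_gt (θ : ℝ) {x : ℝ} (h : p.slopeA θ < x) : p.valueA θ 1 x = 0 := by
  simp [valueA, h]

lemma measurable_valueA (θ : ℝ) : Measurable (p.valueA θ 1) := by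
  unfold valueA
  exact Measurable.indicator (by fun_prop) measurableSet_Ioc

/-- The manager's wealth argument at the tangency point in Case A. -/
lemma wealthA_eq (θ : ℝ) : p.α * θ + (p.m - p.α * (1 + p.m)) * p.v₀ + p.a
    = p.midWealth + p.α * (θ - p.kink₂) := by
  unfold midWealth kink₂; ring

/-- The equation for `θ` is a tangency condition: the tangent to the utility at `θ` passes through
`(0, U 0)`. Extrapolating the top branch to `v = 0` gives the wealth `midWealth - α * kink₂`. -/
lemma Admissible.isThetaA_iff (hp : p.Admissible) {θ : ℝ} : p.IsThetaA θ ↔ p.kink₂ < θ ∧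
    tangentValue p.b (p.midWealth - p.α * p.kink₂) (p.midWealth + p.α * (θ - p.kink₂))
      = isoelastic p.b p.minWealth := by
  unfold IsThetaA
  rw [show (1 + p.m) * p.v₀ = p.kink₂ from rfl]
  refine and_congr_right fun h => ?_
  have hw : 0 < p.midWealth + p.α * (θ - p.kink₂) := by
    nlinarith [hp.midWealth_nonneg, hp.α_mem.1]
  have h1 : 1 - p.b ≠ 0 := sub_ne_zero.2 hp.b_ne_one.symm
  rw [wealthA_eq, show p.b * p.α * θ + (p.m - p.α * (1 + p.m)) * p.v₀ + p.a
    = p.midWealth + p.α * (θ - p.kink₂) + (p.b - 1) * (p.α * θ) by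
      unfold midWealth kink₂; ring, show p.v₀ * (p.m - p.c) + p.a = p.minWealth from rfl]
  set w := p.midWealth + p.α * (θ - p.kink₂) with hwdef
  have he : w - (p.midWealth - p.α * p.kink₂) = p.α * θ := by rw [hwdef]; ring
  unfold tangentValue isoelastic
  rw [he, show w ^ (1 - p.b) = w ^ (-p.b) * w by
    rw [show (1 - p.b) = -p.b + 1 by ring, Real.rpow_add_one hw.ne']]
  constructor
  · intro h; rw [← h]; field_simp; ring
  · intro h; field_simp at h; linarith

/-- Provides the left endpoint for the intermediate value theorem. If `midWealth > 0`, the kink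
itself serves, since `H < α * κ` says that its right tangent meets `v = 0` below `U 0`. If
`midWealth = 0`, the slope there is infinite and a nearby point is taken instead. -/
lemma Admissible.caseA_lower (hp : p.Admissible) (h : p.CaseA) :
    ∀ h > p.midWealth, ∃ w, 0 < w ∧ p.midWealth ≤ w ∧ w < h ∧
      tangentValue p.b (p.midWealth - p.α * p.kink₂) w < isoelastic p.b p.minWealth := by
  intro t ht
  have hα := hp.α_mem.1
  have hk := hp.kink₂_pos
  rcases hp.midWealth_nonneg.eq_or_lt with hN | hN
  · have hB : p.minWealth = 0 := le_antisymm (hN ▸ hp.minWealth_le) hp.minWealth_nonneg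
    have hb : p.b < 1 := by
      by_contra hb
      have := hp.minWealth_pos (lt_of_le_of_ne (not_lt.1 hb) hp.b_ne_one.symm)
      linarith
    have h0 : isoelastic p.b p.minWealth = 0 := by
      rw [hB, isoelastic, Real.zero_rpow (by linarith)]; simp
    obtain ⟨w, hw, hwt, hneg⟩ := exists_tangentValue_neg (e := p.midWealth - p.α * p.kink₂)
      hp.b_pos hb (by nlinarith) (hN ▸ ht)
    exact ⟨w, hw, by linarith, hwt, by rwa [h0]⟩
  · refine ⟨p.midWealth, hN, le_rfl, ht, ?_⟩
    have hH : p.H < p.α * p.κ := h.resolve_left (fun e => hN.ne' e)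
    rw [hp.H_eq, div_lt_iff₀ hk] at hH
    have : p.κ = p.midWealth ^ (-p.b) := rfl
    rw [this] at hH
    unfold tangentValue
    nlinarith

lemma Admissible.existsUnique_thetaA (hp : p.Admissible) (h : p.CaseA) :
    ∃! θ, p.IsThetaA θ := by
  have hα := hp.α_mem.1
  have hN := hp.midWealth_nonneg
  have hk := hp.kink₂_pos
  obtain ⟨w₂, hw₂, hw₂'⟩ := ((eventually_lt_tangentValue (e := p.midWealth - p.α * p.kink₂)
    hp.b_pos hp.b_ne_one hp.minWealth_pos).and (Filter.eventually_gt_atTop p.midWealth)).exists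
  obtain ⟨w₁, h1, hN1, h12, hlow⟩ := hp.caseA_lower h w₂ hw₂'
  obtain ⟨w, ⟨hw1, -⟩, hw⟩ := intermediate_value_Ioo h12.le
    ((continuousOn_tangentValue _ _).mono (fun x hx => h1.trans_le hx.1)) ⟨hlow, hw₂⟩
  refine ⟨p.kink₂ + (w - p.midWealth) / p.α, ?_, ?_⟩
  · refine hp.isThetaA_iff.2 ⟨?_, ?_⟩
    · have : 0 < (w - p.midWealth) / p.α := div_pos (by linarith) hα
      linarith
    · rw [← hw]; congr 1; field_simp; ring
  · intro θ hθ
    obtain ⟨hθ1, hθ2⟩ := hp.isThetaA_iff.1 hθ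
    have hwθ : 0 < p.α * (θ - p.kink₂) := mul_pos hα (by linarith)
    have : p.midWealth + p.α * (θ - p.kink₂) = w := by
      have hak : 0 < p.α * p.kink₂ := mul_pos hα hk
      rcases lt_trichotomy (p.midWealth + p.α * (θ - p.kink₂)) w with hlt | heq | hgt
      · have := tangentValue_lt (e := p.midWealth - p.α * p.kink₂) hp.b_pos hp.b_ne_one
          (by linarith) (by linarith) hlt
        linarith
      · exact heq
      · have := tangentValue_lt (e := p.midWealth - p.α * p.kink₂) hp.b_pos hp.b_ne_one
          (by linarith) (by linarith) hgt
        linarith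
    rw [← this]; field_simp; ring

lemma Admissible.isBestResponse_valueA (hp : p.Admissible) {θ : ℝ} (hθ : p.IsThetaA θ) :
    IsBestResponse p.utility (p.valueA θ 1) (p.slopeA θ) p.b := by
  obtain ⟨hθ1, hθ2⟩ := hp.isThetaA_iff.1 hθ
  have hα := hp.α_mem.1
  have hN := hp.midWealth_nonneg
  have hwθ : 0 < p.α * (θ - p.kink₂) := mul_pos hα (by linarith)
  set w := p.midWealth + p.α * (θ - p.kink₂) with hwdef
  have hw : 0 < w := by linarith
  have hs : p.slopeA θ = p.α * w ^ (-p.b) := by rw [slopeA, wealthA_eq]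
  have hs0 : 0 < p.slopeA θ := by rw [hs]; exact mul_pos hα (Real.rpow_pos_of_pos hw _)
  have hgs : p.valueA θ 1 (p.slopeA θ) = θ := by
    rw [valueA_of_le θ hs0 le_rfl, hp.top_eq hs0, hs, mul_div_cancel_left₀ _ hα.ne',
      rpow_rpow_neg_inv hp.b_pos hw, hwdef]
    field_simp; ring
  have hNx : ∀ x, 0 < x → x ≤ p.slopeA θ → p.midWealth ≤ (x / p.α) ^ (-1 / p.b) := by
    intro x hx hxs
    have : w ≤ (x / p.α) ^ (-1 / p.b) := by
      refine le_rpow_neg_inv hp.b_pos hw (div_pos hx hα) ?_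
      rw [div_le_iff₀ hα, mul_comm, ← hs]; exact hxs
    linarith
  have hA : 0 < p.α ^ (1 / p.b - 1) := Real.rpow_pos_of_pos hα _
  refine IsBestResponse.of_concavification (k := p.kink₁) (measurable_valueA θ) hs0 hp.kink₁_pos
    ?_ ?_ (fun x hx => valueA_of_gt θ hx) ?_ ?_ ?_ ?_
  · intro v _ hv; rw [utility_of_lt hv, hp.utility_zero]
  -- The chord condition is the tangency equation for `θ`.
  · rw [hgs, hp.utility_of_ge hθ1.le, hp.utility_zero, hs, ← hwdef, ← hθ2]
    unfold tangentValue
    rw [hwdef]; ring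
  · intro x hx hxs
    rw [valueA_of_le θ hx hxs]
    exact hp.kink₁_le.trans (hp.kink₂_le_top hx (hNx x hx hxs))
  · intro x v hx hxs hv hne
    rw [valueA_of_le θ hx hxs] at hne ⊢
    exact hp.opt_top' hx (hNx x hx hxs) hv hne
  · refine ⟨p.α ^ (1 / p.b - 1) + |p.L|, fun x hx => ?_⟩
    rcases lt_or_ge (p.slopeA θ) x with h | h
    · rw [valueA_of_gt θ h]
      have := Real.rpow_nonneg hx.le (-1 / p.b)
      positivity
    · rw [valueA_of_le θ hx h]
      exact top_le_growth hA.le hx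
  · exact tendsto_rpow_nhdsGT_zero_of_eq hA hp.b_pos hs0 fun x hx hxs => valueA_of_le θ hx hxs.le

lemma Admissible.midWealth_pos (hp : p.Admissible) (h : p.m * p.v₀ + p.a ≠ 0) :
    0 < p.midWealth := lt_of_le_of_ne hp.midWealth_nonneg (Ne.symm h)

/-! ### Case B -/

lemma valueB_eq {y : ℝ} (hy : 0 < y) (z : ℝ) : p.valueB y z = p.valueB 1 (y * z) := by
  simp only [valueB, indicator, mem_Icc, mem_Ioo, div_one, one_mul]
  simp only [le_div_iff₀ hy, lt_div_iff₀ hy, div_le_iff₀ hy, mul_comm z y,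
    mul_pos_iff_of_pos_left hy]

lemma valueB_of_lt {x : ℝ} (hx : 0 < x) (h : x < p.α * p.κ) :
    p.valueB 1 x = p.α ^ (1 / p.b - 1) * x ^ (-1 / p.b) + p.L := by
  simp [valueB, hx, h]

lemma valueB_of_mid {x : ℝ} (h : p.α * p.κ ≤ x) (h' : x ≤ p.H) :
    p.valueB 1 x = p.kink₂ := by
  simp [valueB, h, h', kink₂]

lemma valueB_of_gt (h0 : p.α * p.κ ≤ p.H) {x : ℝ} (h : p.H < x) : p.valueB 1 x = 0 := by
  simp [valueB, h, h0.trans h.le]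

lemma measurable_valueB : Measurable (p.valueB 1) := by
  unfold valueB
  exact (Measurable.indicator (by fun_prop) measurableSet_Ioo).add
    (Measurable.indicator (by fun_prop) measurableSet_Icc)

/-- The chord ends at the upper kink, where its slope `H` is a supergradient, so there is no
tangency to solve; the chord condition is the definition of `H`. -/
lemma Admissible.isBestResponse_valueB (hp : p.Admissible) (h : p.CaseB) :
    IsBestResponse p.utility (p.valueB 1) p.H p.b := by
  obtain ⟨hN, h1, h2⟩ := h
  replace hN := hp.midWealth_pos hN
  have hα := hp.α_mem.1
  have hk := hp.kink₂_pos
  have hκ : 0 < p.κ := Real.rpow_pos_of_pos hN _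
  have hακ : 0 < p.α * p.κ := mul_pos hα hκ
  have hs0 : 0 < p.H := hακ.trans_le h1
  have hA : 0 < p.α ^ (1 / p.b - 1) := Real.rpow_pos_of_pos hα _
  refine IsBestResponse.of_concavification (k := p.kink₁) measurable_valueB hs0 hp.kink₁_pos
    ?_ ?_ (fun x hx => valueB_of_gt h1 hx) ?_ ?_ ?_ ?_
  · intro v _ hv; rw [utility_of_lt hv, hp.utility_zero]
  · rw [valueB_of_mid h1 le_rfl, hp.utility_kink₂, hp.utility_zero, hp.H_eq]
    field_simp; ring
  · intro x hx hxs
    rcases lt_or_ge x (p.α * p.κ) with h | h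
    · rw [valueB_of_lt hx h]
      exact hp.kink₁_le.trans (hp.kink₂_le_top hx (hp.le_rpow_of_le_κ hx hN h.le))
    · rw [valueB_of_mid h hxs]; exact hp.kink₁_le
  · intro x v hx hxs hv hne
    rcases lt_or_ge x (p.α * p.κ) with h | h
    · rw [valueB_of_lt hx h] at hne ⊢
      exact hp.opt_top' hx (hp.le_rpow_of_le_κ hx hN h.le) hv hne
    · rw [valueB_of_mid h hxs] at hne ⊢
      exact hp.opt_kink hN h (hxs.trans h2) hv hne
  · refine ⟨p.α ^ (1 / p.b - 1) + |p.L| + p.kink₂, fun x hx => ?_⟩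
    have hr := Real.rpow_nonneg hx.le (-1 / p.b)
    rcases lt_or_ge x (p.α * p.κ) with h | h
    · rw [valueB_of_lt hx h]
      have := top_le_growth (D := p.L) (b := p.b) hA.le hx
      nlinarith
    · rcases le_or_gt x p.H with h' | h'
      · rw [valueB_of_mid h h']
        have : 0 ≤ p.α ^ (1 / p.b - 1) + |p.L| := by positivity
        nlinarith
      · rw [valueB_of_gt h1 h']; positivity
  · exact tendsto_rpow_nhdsGT_zero_of_eq hA hp.b_pos hακ fun x hx hxs => valueB_of_lt hx hxs

/-! ### Case C -/

lemma valueC_eq (θ : ℝ) {y : ℝ} (hy : 0 < y) (z : ℝ) :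
    p.valueC θ y z = p.valueC θ 1 (y * z) := by
  simp only [valueC, indicator, mem_Icc, mem_Ioo, mem_Ioc, div_one, one_mul]
  simp only [le_div_iff₀ hy, lt_div_iff₀ hy, div_le_iff₀ hy, div_lt_iff₀ hy, mul_comm z y,
    mul_pos_iff_of_pos_left hy]

lemma valueC_of_lt (θ : ℝ) (h1 : p.α * p.κ ≤ p.κ) {x : ℝ} (hx : 0 < x) (h : x < p.α * p.κ) :
    p.valueC θ 1 x = p.α ^ (1 / p.b - 1) * x ^ (-1 / p.b) + p.L := by
  have : ¬ p.κ < x := by linarith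
  simp [valueC, hx, h, this]

lemma valueC_of_kink (θ : ℝ) {x : ℝ} (h : p.α * p.κ ≤ x) (h' : x ≤ p.κ) :
    p.valueC θ 1 x = p.kink₂ := by
  simp [valueC, h, h', kink₂]

lemma valueC_of_mid (θ : ℝ) (h1 : p.α * p.κ ≤ p.κ) {x : ℝ} (h : p.κ < x)
    (h' : x ≤ p.slopeC θ) : p.valueC θ 1 x = x ^ (-1 / p.b) + p.v₀ - p.a := by
  have : p.α * p.κ ≤ x := by linarith
  simp [valueC, h, h', this]

lemma valueC_of_gt (θ : ℝ) (h1 : p.α * p.κ ≤ p.κ) (h2 : p.κ < p.slopeC θ) {x : ℝ}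
    (h : p.slopeC θ < x) : p.valueC θ 1 x = 0 := by
  have h3 : p.α * p.κ ≤ x := by linarith
  have h4 : p.κ < x := by linarith
  simp [valueC, h, h3, h4]

lemma measurable_valueC (θ : ℝ) : Measurable (p.valueC θ 1) := by
  unfold valueC
  exact ((Measurable.indicator (by fun_prop) measurableSet_Ioo).add
    (Measurable.indicator (by fun_prop) measurableSet_Icc)).add
    (Measurable.indicator (by fun_prop) measurableSet_Ioc)

/-- Tangency as in Case A, now on the middle branch, where wealth is `v - v₀ + a` and `v = 0`
extrapolates to `a - v₀`. -/
lemma Admissible.isThetaC_iff (hp : p.Admissible) {θ : ℝ} : p.IsThetaC θ ↔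
    p.kink₁ < θ ∧ θ < p.kink₂ ∧
    tangentValue p.b (p.a - p.v₀) (θ - p.v₀ + p.a) = isoelastic p.b p.minWealth := by
  unfold IsThetaC
  rw [show (1 + p.m) * p.v₀ = p.kink₂ from rfl, show (1 + p.m - p.c) * p.v₀ = p.kink₁ from rfl]
  refine and_congr_right fun h => and_congr_right fun _ => ?_
  have hw : 0 < θ - p.v₀ + p.a := by
    have := hp.minWealth_nonneg
    unfold kink₁ at h; unfold minWealth at this
    linarith
  have h1 : 1 - p.b ≠ 0 := sub_ne_zero.2 hp.b_ne_one.symm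
  rw [show p.b * θ - p.v₀ + p.a = θ - p.v₀ + p.a + (p.b - 1) * θ by ring,
    show p.v₀ * (p.m - p.c) + p.a = p.minWealth from rfl]
  set w := θ - p.v₀ + p.a with hwdef
  have he : w - (p.a - p.v₀) = θ := by rw [hwdef]; ring
  unfold tangentValue isoelastic
  rw [he, show w ^ (1 - p.b) = w ^ (-p.b) * w by
    rw [show (1 - p.b) = -p.b + 1 by ring, Real.rpow_add_one hw.ne']]
  constructor
  · intro h; rw [← h]; field_simp; ring
  · intro h; field_simp at h; linarith

lemma kink₁_eq_sub (p : FundModel) : p.kink₁ = p.minWealth - (p.a - p.v₀) := by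
  unfold kink₁ minWealth; ring

lemma kink₂_eq_sub (p : FundModel) : p.kink₂ = p.midWealth - (p.a - p.v₀) := by
  unfold kink₂ midWealth; ring

lemma Admissible.existsUnique_thetaC (hp : p.Admissible) (h : p.CaseC) :
    ∃! θ, p.IsThetaC θ := by
  obtain ⟨hN, hH⟩ := h
  replace hN := hp.midWealth_pos hN
  have hB := hp.minWealth_nonneg
  have hk := hp.kink₂_pos
  have hk₁ := hp.kink₁_pos
  have hκ : 0 < p.κ := Real.rpow_pos_of_pos hN _
  have e1 := kink₁_eq_sub p
  have e2 := kink₂_eq_sub p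
  -- Right endpoint: `κ < H` says that the left tangent at the upper kink meets `v = 0` above `U 0`.
  have hup : isoelastic p.b p.minWealth < tangentValue p.b (p.a - p.v₀) p.midWealth := by
    rw [hp.H_eq, lt_div_iff₀ hk] at hH
    unfold tangentValue
    rw [← e2]
    have : p.κ = p.midWealth ^ (-p.b) := rfl
    rw [← this]; linarith
  -- Equality would give `H = 0`, contradicting `0 < κ < H`.
  have hBN : p.minWealth < p.midWealth := by
    refine lt_of_le_of_ne hp.minWealth_le fun e => ?_
    rw [hp.H_eq, e] at hH
    simp at hH; linarith
  -- Left endpoint: the increasing tangent at the lower kink, where the utility still equals `U 0`,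
  -- is below `U 0` at `v = 0`. Zero minimal wealth again requires a nearby point.
  obtain ⟨w₁, h1, hB1, h12, hlow⟩ : ∃ w, 0 < w ∧ p.minWealth ≤ w ∧ w < p.midWealth ∧
      tangentValue p.b (p.a - p.v₀) w < isoelastic p.b p.minWealth := by
    rcases hB.eq_or_lt with hB | hB
    · have hb : p.b < 1 := by
        by_contra hb
        have := hp.minWealth_pos (lt_of_le_of_ne (not_lt.1 hb) hp.b_ne_one.symm)
        linarith
      have h0 : isoelastic p.b p.minWealth = 0 := by
        rw [← hB, isoelastic, Real.zero_rpow (by linarith)]; simp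
      obtain ⟨w, hw, hwt, hneg⟩ := exists_tangentValue_neg (e := p.a - p.v₀)
        hp.b_pos hb (by linarith) hN
      exact ⟨w, hw, by linarith, hwt, by rwa [h0]⟩
    · refine ⟨p.minWealth, hB, le_rfl, hBN, ?_⟩
      unfold tangentValue
      rw [← e1]
      have := mul_pos (Real.rpow_pos_of_pos hB (-p.b)) hk₁
      linarith
  obtain ⟨w, ⟨hw1, hw2⟩, hw⟩ := intermediate_value_Ioo h12.le
    ((continuousOn_tangentValue _ _).mono (fun x hx => h1.trans_le hx.1)) ⟨hlow, hup⟩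
  refine ⟨w - (p.a - p.v₀), ?_, ?_⟩
  · refine hp.isThetaC_iff.2 ⟨by linarith, by linarith, ?_⟩
    rw [← hw]; congr 1; ring
  · intro θ hθ
    obtain ⟨hθ1, hθ2, hθ3⟩ := hp.isThetaC_iff.1 hθ
    have : θ - p.v₀ + p.a = w := by
      rcases lt_trichotomy (θ - p.v₀ + p.a) w with hlt | heq | hgt
      · have := tangentValue_lt (e := p.a - p.v₀) hp.b_pos hp.b_ne_one
          (by linarith) (by linarith) hlt
        linarith
      · exact heq
      · have := tangentValue_lt (e := p.a - p.v₀) hp.b_pos hp.b_ne_one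
          (by linarith) (by linarith) hgt
        linarith
    rw [← this]; ring

lemma Admissible.κ_lt_slopeC (hp : p.Admissible) {θ : ℝ} (hθ : p.IsThetaC θ) :
    p.κ < p.slopeC θ := by
  obtain ⟨hθ1, hθ2, -⟩ := hp.isThetaC_iff.1 hθ
  have hB := hp.minWealth_nonneg
  have e1 := kink₁_eq_sub p
  have e2 := kink₂_eq_sub p
  exact Real.rpow_lt_rpow_of_neg (by linarith)
    (show θ - p.v₀ + p.a < p.midWealth by linarith) (by linarith [hp.b_pos])

lemma Admissible.isBestResponse_valueC (hp : p.Admissible) (h : p.CaseC) {θ : ℝ}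
    (hθ : p.IsThetaC θ) : IsBestResponse p.utility (p.valueC θ 1) (p.slopeC θ) p.b := by
  have hN := hp.midWealth_pos h.1
  obtain ⟨hθ1, hθ2, hθ3⟩ := hp.isThetaC_iff.1 hθ
  have hB := hp.minWealth_nonneg
  have e1 := kink₁_eq_sub p
  have e2 := kink₂_eq_sub p
  have hα := hp.α_mem.1
  have hk := hp.kink₂_pos
  have hκ : 0 < p.κ := Real.rpow_pos_of_pos hN _
  have hακ : 0 < p.α * p.κ := mul_pos hα hκ
  have h1 : p.α * p.κ ≤ p.κ := by nlinarith [hp.α_mem.2]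
  have h2 := hp.κ_lt_slopeC hθ
  have hs0 : 0 < p.slopeC θ := hκ.trans h2
  have hA : 0 < p.α ^ (1 / p.b - 1) := Real.rpow_pos_of_pos hα _
  set w := θ - p.v₀ + p.a with hwdef
  have hw : 0 < w := by linarith
  have hs : p.slopeC θ = w ^ (-p.b) := rfl
  have hgs : p.valueC θ 1 (p.slopeC θ) = θ := by
    rw [valueC_of_mid θ h1 h2 le_rfl, hs, rpow_rpow_neg_inv hp.b_pos hw, hwdef]; ring
  have hmid : ∀ x, x ^ (-1 / p.b) + p.v₀ - p.a
      = p.kink₂ + (x ^ (-1 / p.b) - p.midWealth) := by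
    intro x; rw [e2]; ring
  have hwx : ∀ x, 0 < x → x ≤ p.slopeC θ → w ≤ x ^ (-1 / p.b) := fun x hx hxs =>
    le_rpow_neg_inv hp.b_pos hw hx hxs
  refine IsBestResponse.of_concavification (k := p.kink₁) (measurable_valueC θ) hs0 hp.kink₁_pos
    ?_ ?_ (fun x hx => valueC_of_gt θ h1 h2 hx) ?_ ?_ ?_ ?_
  · intro v _ hv; rw [utility_of_lt hv, hp.utility_zero]
  · rw [hgs, utility_of_mid hθ1.le hθ2, hp.utility_zero, hs, ← hθ3]
    unfold tangentValue
    rw [show p.midWealth + (θ - p.kink₂) = w by linarith]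
    rw [show w - (p.a - p.v₀) = θ by rw [hwdef]; ring]; ring
  · intro x hx hxs
    rcases lt_or_ge x (p.α * p.κ) with h | h
    · rw [valueC_of_lt θ h1 hx h]
      exact hp.kink₁_le.trans (hp.kink₂_le_top hx (hp.le_rpow_of_le_κ hx hN h.le))
    · rcases le_or_gt x p.κ with h' | h'
      · rw [valueC_of_kink θ h h']; exact hp.kink₁_le
      · rw [valueC_of_mid θ h1 h' hxs]
        linarith [hwx x hx hxs]
  · intro x v hx hxs hv hne
    rcases lt_or_ge x (p.α * p.κ) with h | h
    · rw [valueC_of_lt θ h1 hx h] at hne ⊢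
      exact hp.opt_top' hx (hp.le_rpow_of_le_κ hx hN h.le) hv hne
    · rcases le_or_gt x p.κ with h' | h'
      · rw [valueC_of_kink θ h h'] at hne ⊢
        exact hp.opt_kink hN h h' hv hne
      · rw [valueC_of_mid θ h1 h' hxs, hmid] at hne ⊢
        have := hp.opt_mid (w := x ^ (-1 / p.b)) (Real.rpow_pos_of_pos hx _)
          (by linarith [hwx x hx hxs]) (rpow_neg_inv_lt hp.b_pos hN h') hv hne
        rwa [rpow_neg_inv_rpow hp.b_pos hx] at this
  · refine ⟨p.α ^ (1 / p.b - 1) + |p.L| + p.kink₂ + (1 + |p.v₀ - p.a|), fun x hx => ?_⟩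
    have hr := Real.rpow_nonneg hx.le (-1 / p.b)
    have hL := top_le_growth (D := p.L) (b := p.b) hA.le hx
    have hM := top_le_growth (A := 1) (D := p.v₀ - p.a) (b := p.b) zero_le_one hx
    have t1 : 0 ≤ p.α ^ (1 / p.b - 1) + |p.L| := by positivity
    have t2 : 0 ≤ 1 + |p.v₀ - p.a| := by positivity
    have s1 := mul_nonneg t1 hr
    have s2 := mul_nonneg t2 hr
    have s3 := mul_nonneg hk.le hr
    rcases lt_or_ge x (p.α * p.κ) with h | h
    · rw [valueC_of_lt θ h1 hx h]
      linarith
    · rcases le_or_gt x p.κ with h' | h'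
      · rw [valueC_of_kink θ h h']
        linarith
      · rcases le_or_gt x (p.slopeC θ) with h'' | h''
        · rw [valueC_of_mid θ h1 h' h'']
          linarith
        · rw [valueC_of_gt θ h1 h2 h'']; positivity
  · exact tendsto_rpow_nhdsGT_zero_of_eq hA hp.b_pos hακ fun x hx hxs =>
      valueC_of_lt θ h1 hx hxs

end FundModel

end

/-! ### Duality: multiplier, optimality and uniqueness -/

noncomputable section

/-- A positive random variable with finite moments of all real orders whose law has no atoms and
charges every interval of positive reals. -/
structure IsDiffuseDeflator {Ω : Type*} {mΩ : MeasurableSpace Ω} (Q : Measure Ω) (ζ : Ω → ℝ) :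
    Prop where
  measurable : Measurable ζ
  pos : ∀ ω, 0 < ζ ω
  integrable_rpow : ∀ k : ℝ, Integrable (fun ω => ζ ω ^ k) Q
  null : ∀ x, Q {ω | ζ ω = x} = 0
  charge : ∀ x y, 0 ≤ x → x < y → Q {ω | x < ζ ω ∧ ζ ω < y} ≠ 0

variable {Ω : Type*} {mΩ : MeasurableSpace Ω} {Q : Measure Ω} {ζ : Ω → ℝ} {U g : ℝ → ℝ} {s b : ℝ}

namespace IsBestResponse

/-- Adding the optimality inequalities of `g x` and `g y` against each other leaves `(y - x) * (g x
- g y) ≥ 0`. -/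
lemma antitoneOn (hg : IsBestResponse U g s b) : AntitoneOn g (Ioi 0) := by
  intro x hx y hy hxy
  rcases hxy.eq_or_lt with rfl | hlt
  · exact le_rfl
  · have h1 := hg.le x (g y) hx (hg.nonneg y hy)
    have h2 := hg.le y (g x) hy (hg.nonneg x hx)
    by_contra h
    nlinarith [mul_pos (sub_pos.2 hlt) (sub_pos.2 (not_le.1 h))]

lemma pos_of_le (hg : IsBestResponse U g s b) {x : ℝ} (hx : 0 < x) (h : x ≤ s) : 0 < g x :=
  hg.pos.trans_le (hg.antitoneOn hx hg.s_pos h)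

lemma abs_le_growth (hg : IsBestResponse U g s b) : ∃ C, ∀ y ω, 0 < y → 0 < ζ ω →
    |g (y * ζ ω)| ≤ C * (1 + y ^ (-1 / b) * ζ ω ^ (-1 / b)) := by
  obtain ⟨C, hC⟩ := hg.growth
  refine ⟨C, fun y ω hy hω => ?_⟩
  rw [abs_of_nonneg (hg.nonneg _ (mul_pos hy hω)), ← Real.mul_rpow hy.le hω.le]
  exact hC _ (mul_pos hy hω)

lemma integrable (hg : IsBestResponse U g s b) [IsProbabilityMeasure Q]
    (hζ : IsDiffuseDeflator Q ζ) {y : ℝ} (hy : 0 < y) :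
    Integrable (fun ω => g (y * ζ ω)) Q := by
  obtain ⟨C, hC⟩ := hg.abs_le_growth (ζ := ζ)
  refine Integrable.mono' (g := fun ω => C * (1 + y ^ (-1 / b) * ζ ω ^ (-1 / b))) ?_ ?_ ?_
  · exact ((integrable_const _).add ((hζ.integrable_rpow _).const_mul _)).const_mul _
  · exact (hg.measurable.comp (hζ.measurable.const_mul y)).aestronglyMeasurable
  · exact .of_forall fun ω => hC y ω hy (hζ.pos ω)

lemma integrable_mul (hg : IsBestResponse U g s b) (hζ : IsDiffuseDeflator Q ζ) {y : ℝ}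
    (hy : 0 < y) : Integrable (fun ω => ζ ω * g (y * ζ ω)) Q := by
  obtain ⟨C, hC⟩ := hg.abs_le_growth (ζ := ζ)
  refine Integrable.mono'
    (g := fun ω => C * (ζ ω ^ (1 : ℝ) + y ^ (-1 / b) * ζ ω ^ (-1 / b + 1))) ?_ ?_ ?_
  · exact ((hζ.integrable_rpow 1).add ((hζ.integrable_rpow _).const_mul _)).const_mul _
  · exact (hζ.measurable.mul
      (hg.measurable.comp (hζ.measurable.const_mul y))).aestronglyMeasurable
  · refine .of_forall fun ω => ?_
    have h := hζ.pos ω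
    rw [Real.rpow_add_one h.ne', Real.rpow_one, norm_mul, Real.norm_eq_abs, Real.norm_eq_abs,
      abs_of_pos h]
    nlinarith [mul_le_mul_of_nonneg_left (hC y ω hy h) h.le]

/-- Optimality against `v = 0` bounds the utility below by `U 0`; optimality of `g s` at price `s`
bounds it above by an affine function of the terminal value. -/
lemma integrable_utility (hg : IsBestResponse U g s b) [IsProbabilityMeasure Q]
    (hU : Measurable U) (hζ : IsDiffuseDeflator Q ζ) {y : ℝ} (hy : 0 < y) :
    Integrable (fun ω => U (g (y * ζ ω))) Q := by
  refine integrable_of_le_of_le (g₁ := fun _ => U 0)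
    (g₂ := fun ω => U (g s) - s * g s + s * g (y * ζ ω)) ?_ ?_ ?_ (integrable_const _) ?_
  · exact (hU.comp (hg.measurable.comp (hζ.measurable.const_mul y))).aestronglyMeasurable
  · refine .of_forall fun ω => ?_
    have hx := mul_pos hy (hζ.pos ω)
    have := hg.le _ 0 hx le_rfl
    have := mul_nonneg hx.le (hg.nonneg _ hx)
    simp only; linarith
  · refine .of_forall fun ω => ?_
    have hx := mul_pos hy (hζ.pos ω)
    have := hg.le s _ hg.s_pos (hg.nonneg _ hx)
    simp only; linarith
  · exact (integrable_const _).add ((hg.integrable hζ hy).const_mul s)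

/-- Although `g` jumps, it is monotone and so has countably many discontinuities, which `ζ` avoids
almost surely. Monotonicity also supplies the dominating function, at `y₀ / 2`. -/
lemma continuousOn_budget (hg : IsBestResponse U g s b) (hζ : IsDiffuseDeflator Q ζ) :
    ContinuousOn (fun y => ∫ ω, ζ ω * g (y * ζ ω) ∂Q) (Ioi 0) := by
  intro y₀ hy₀
  refine ContinuousAt.continuousWithinAt ?_
  have hy₀ : 0 < y₀ := hy₀
  refine continuousAt_of_dominated (bound := fun ω => ζ ω * g (y₀ / 2 * ζ ω)) ?_ ?_
    (hg.integrable_mul hζ (half_pos hy₀)) ?_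
  · exact .of_forall fun y => (hζ.measurable.mul
      (hg.measurable.comp (hζ.measurable.const_mul y))).aestronglyMeasurable
  · filter_upwards [Ioi_mem_nhds (half_lt_self hy₀)] with y hy
    refine .of_forall fun ω => ?_
    have h := hζ.pos ω
    have hy' : y₀ / 2 < y := hy
    have hy0 : 0 < y₀ / 2 := half_pos hy₀
    have h1 : 0 < y * ζ ω := mul_pos (hy0.trans hy') h
    rw [Real.norm_eq_abs, abs_of_nonneg (mul_nonneg h.le (hg.nonneg _ h1))]
    refine mul_le_mul_of_nonneg_left (hg.antitoneOn (mul_pos hy0 h) h1 ?_) h.le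
    exact mul_le_mul_of_nonneg_right hy'.le h.le
  · have hD := hg.antitoneOn.countable_not_continuousWithinAt
    have hnull : Q (⋃ x ∈ {x ∈ Ioi (0 : ℝ) | ¬ContinuousWithinAt g (Ioi 0) x},
        {ω | ζ ω = x / y₀}) = 0 :=
      (measure_biUnion_null_iff hD).2 fun x _ => hζ.null _
    filter_upwards [compl_mem_ae_iff.2 hnull] with ω hω
    have h := mul_pos hy₀ (hζ.pos ω)
    have hc : ContinuousAt g (y₀ * ζ ω) := by
      by_contra hc
      refine hω (mem_biUnion (x := y₀ * ζ ω) ⟨h, fun h' => hc (h'.continuousAt (Ioi_mem_nhds h))⟩ ?_)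
      simp only [mem_ofPred_eq]
      field_simp
    refine continuousAt_const.mul ?_
    exact ContinuousAt.comp (f := fun y : ℝ => y * ζ ω) (g := g) hc (by fun_prop)

lemma existsUnique_multiplier (hg : IsBestResponse U g s b) (hζ : IsDiffuseDeflator Q ζ)
    {v₀ : ℝ} (hv : 0 < v₀) : ∃! y, 0 < y ∧ ∫ ω, ζ ω * g (y * ζ ω) ∂Q = v₀ := by
  set G := fun y => ∫ ω, ζ ω * g (y * ζ ω) ∂Q with hG
  have hint1 : Integrable ζ Q := by simpa using hζ.integrable_rpow 1
  have hmset : MeasurableSet {ω | ζ ω < 1} := measurableSet_lt hζ.measurable measurable_const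
  -- On `ζ < 1` monotonicity gives `g (y * ζ) ≥ g y`, and `g y` is unbounded as `y` decreases to
  -- `0`.
  have hsmall : ∃ y, 0 < y ∧ v₀ < G y := by
    set c := ∫ ω in {ω | ζ ω < 1}, ζ ω ∂Q with hc
    have hc0 : 0 < c := by
      rw [hc, setIntegral_pos_iff_support_of_nonneg_ae (.of_forall fun ω => (hζ.pos ω).le)
        hint1.integrableOn]
      refine lt_of_lt_of_le (pos_iff_ne_zero.2 (hζ.charge 0 1 le_rfl one_pos))
        (measure_mono fun ω hω => ⟨(hζ.pos ω).ne', hω.2⟩)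
    obtain ⟨y, hy, hy0⟩ := ((hg.tendsto.eventually_gt_atTop (v₀ / c)).and
      self_mem_nhdsWithin).exists
    have hy0 : 0 < y := hy0
    refine ⟨y, hy0, ?_⟩
    calc v₀ < g y * c := (div_lt_iff₀ hc0).1 hy
      _ = ∫ ω in {ω | ζ ω < 1}, g y * ζ ω ∂Q := by rw [integral_const_mul]
      _ ≤ ∫ ω in {ω | ζ ω < 1}, ζ ω * g (y * ζ ω) ∂Q := by
          refine setIntegral_mono_on (hint1.const_mul _).integrableOn
            (hg.integrable_mul hζ hy0).integrableOn hmset fun ω hω => ?_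
          have h := hζ.pos ω
          have h1 : ζ ω < 1 := hω
          rw [mul_comm]
          refine mul_le_mul_of_nonneg_left (hg.antitoneOn (mul_pos hy0 h) hy0 ?_) h.le
          nlinarith
      _ ≤ G y := setIntegral_le_integral (hg.integrable_mul hζ hy0) (.of_forall fun ω =>
          mul_nonneg (hζ.pos ω).le (hg.nonneg _ (mul_pos hy0 (hζ.pos ω))))
  have hlarge : ∃ y, 0 < y ∧ G y < v₀ := by
    have hlim : Filter.Tendsto G Filter.atTop (nhds (∫ _, (0 : ℝ) ∂Q)) := by
      refine tendsto_integral_filter_of_dominated_convergence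
        (fun ω => ζ ω * g (1 * ζ ω)) ?_ ?_ (hg.integrable_mul hζ one_pos) ?_
      · exact .of_forall fun y => (hζ.measurable.mul
          (hg.measurable.comp (hζ.measurable.const_mul y))).aestronglyMeasurable
      · filter_upwards [Filter.eventually_ge_atTop 1] with y hy
        refine .of_forall fun ω => ?_
        have h := hζ.pos ω
        have h1 : 0 < y * ζ ω := mul_pos (by linarith) h
        rw [Real.norm_eq_abs, abs_of_nonneg (mul_nonneg h.le (hg.nonneg _ h1))]
        refine mul_le_mul_of_nonneg_left (hg.antitoneOn (mul_pos one_pos h) h1 ?_) h.le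
        exact mul_le_mul_of_nonneg_right hy h.le
      · refine .of_forall fun ω => ?_
        refine tendsto_const_nhds.congr' ?_
        filter_upwards [Filter.eventually_gt_atTop (s / ζ ω)] with y hy
        rw [hg.eq_zero _ ((div_lt_iff₀ (hζ.pos ω)).1 hy), mul_zero]
    rw [integral_zero] at hlim
    obtain ⟨y, hy, hy0⟩ := ((hlim.eventually_lt_const hv).and
      (Filter.eventually_gt_atTop 0)).exists
    exact ⟨y, hy0, hy⟩
  -- On the event `s / y' < ζ < s / y`, which has positive probability, the integrand is positive
  -- for `y` and zero for `y'`.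
  have hanti : ∀ y y', 0 < y → y < y' → G y ≠ G y' := by
    intro y y' hy hyy' heq
    have hy' := hy.trans hyy'
    have hnn : ∀ ω, 0 ≤ ζ ω * g (y * ζ ω) - ζ ω * g (y' * ζ ω) := by
      intro ω
      have h := hζ.pos ω
      have := hg.antitoneOn (mul_pos hy h) (mul_pos hy' h)
        (mul_le_mul_of_nonneg_right hyy'.le h.le)
      nlinarith
    have h0 : ∫ ω, (ζ ω * g (y * ζ ω) - ζ ω * g (y' * ζ ω)) ∂Q = 0 := by
      rw [integral_sub (hg.integrable_mul hζ hy) (hg.integrable_mul hζ hy')]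
      exact sub_eq_zero.2 heq
    rw [integral_eq_zero_iff_of_nonneg hnn
      ((hg.integrable_mul hζ hy).sub (hg.integrable_mul hζ hy'))] at h0
    refine hζ.charge (s / y') (s / y) (div_pos hg.s_pos hy').le
      (div_lt_div_of_pos_left hg.s_pos hy hyy') (measure_mono_null ?_ (ae_iff.1 h0))
    rintro ω ⟨h1, h2⟩
    have h := hζ.pos ω
    rw [div_lt_iff₀ hy'] at h1
    rw [lt_div_iff₀ hy] at h2
    have h3 := hg.eq_zero (y' * ζ ω) (by linarith)
    have h4 := hg.pos_of_le (mul_pos hy h) (by linarith)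
    have : ζ ω * g (y * ζ ω) ≠ 0 := (mul_pos h h4).ne'
    simpa [h3] using this
  obtain ⟨y₁, h1, h1'⟩ := hsmall
  obtain ⟨y₂, h2, h2'⟩ := hlarge
  obtain ⟨y, hy, hyv⟩ := isPreconnected_Ioi.intermediate_value (show y₂ ∈ Ioi (0 : ℝ) from h2)
    (show y₁ ∈ Ioi (0 : ℝ) from h1) (hg.continuousOn_budget hζ) ⟨h2'.le, h1'.le⟩
  refine ⟨y, ⟨hy, hyv⟩, ?_⟩
  rintro y' ⟨hy', hyv'⟩
  rcases lt_trichotomy y y' with h | h | h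
  · exact absurd (hyv.trans hyv'.symm) (hanti _ _ hy h)
  · exact h.symm
  · exact absurd (hyv'.trans hyv.symm) (hanti _ _ hy' h)

end IsBestResponse

lemma FundModel.extExpectation_eq_integral {X : Ω → ℝ} (hX : Integrable X Q) :
    FundModel.extExpectation Q X = ((∫ ω, X ω ∂Q : ℝ) : EReal) := by
  have h1 : ∫⁻ ω, ENNReal.ofReal (X ω) ∂Q ≠ ⊤ := hX.lintegral_lt_top.ne
  have h2 : ∫⁻ ω, ENNReal.ofReal (-X ω) ∂Q ≠ ⊤ := hX.neg.lintegral_lt_top.ne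
  rw [FundModel.extExpectation, integral_eq_lintegral_pos_part_sub_lintegral_neg_part hX,
    EReal.coe_sub, EReal.coe_ennreal_toReal h1, EReal.coe_ennreal_toReal h2]

/-- Needs no integrability, so it applies to the utility of an arbitrary feasible competitor. -/
lemma FundModel.extExpectation_mono {X Y : Ω → ℝ} (h : ∀ᵐ ω ∂Q, X ω ≤ Y ω) :
    FundModel.extExpectation Q X ≤ FundModel.extExpectation Q Y := by
  refine EReal.sub_le_sub ?_ ?_
  · refine EReal.coe_ennreal_le_coe_ennreal_iff.2 (lintegral_mono_ae ?_)
    filter_upwards [h] with ω hω using ENNReal.ofReal_le_ofReal hω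
  · refine EReal.coe_ennreal_le_coe_ennreal_iff.2 (lintegral_mono_ae ?_)
    filter_upwards [h] with ω hω using ENNReal.ofReal_le_ofReal (neg_le_neg hω)

namespace FundModel

variable {p : FundModel} {ℱ : Filtration ℝ≥0 mΩ} {W : ℝ≥0 → Ω → ℝ}

lemma measurable_Z (p : FundModel) {T : ℝ≥0} {m : MeasurableSpace Ω} (h : Measurable (W T)) :
    Measurable (p.Z W T) := by
  unfold Z
  exact (measurable_const.sub (h.const_mul _)).exp

theorem isOptimal_of_isBestResponse [IsProbabilityMeasure Q]
    (hg : IsBestResponse p.utility g s b) (hW : Measurable[ℱ p.T] (W p.T))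
    (hζ : IsDiffuseDeflator Q (p.Z W p.T)) {y : ℝ} (hy : 0 < y)
    (hbudget : ∫ ω, p.Z W p.T ω * g (y * p.Z W p.T ω) ∂Q = p.v₀) :
    p.IsOptimal ℱ Q W (fun ω => g (y * p.Z W p.T ω)) := by
  have hUint := hg.integrable_utility (measurable_utility p) hζ hy
  have hgint := hg.integrable_mul hζ hy
  refine ⟨⟨?_, ?_, hgint, hbudget.le⟩, hUint, ?_⟩
  · exact hg.measurable.comp ((measurable_Z p hW).const_mul y)
  · exact .of_forall fun ω => hg.nonneg _ (mul_pos hy (hζ.pos ω))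
  · intro V hV
    -- The Lagrangian bound on the utility of `V`; its budget term has nonpositive expectation.
    set Y := fun ω => p.utility (g (y * p.Z W p.T ω))
      + y * (p.Z W p.T ω * V ω - p.Z W p.T ω * g (y * p.Z W p.T ω)) with hY
    have hYint : Integrable Y Q := hUint.add ((hV.integrable.sub hgint).const_mul y)
    have hle : ∀ᵐ ω ∂Q, p.utility (V ω) ≤ Y ω := by
      filter_upwards [hV.nonneg] with ω hω
      have := hg.le _ _ (mul_pos hy (hζ.pos ω)) hω
      simp only [hY]; linarith
    refine (extExpectation_mono hle).trans ?_
    rw [FundModel.extExpectation_eq_integral hYint, FundModel.extExpectation_eq_integral hUint,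
      EReal.coe_le_coe_iff]
    have hYval : ∫ ω, Y ω ∂Q = ∫ ω, p.utility (g (y * p.Z W p.T ω)) ∂Q
        + y * (∫ ω, p.Z W p.T ω * V ω ∂Q - p.v₀) := by
      rw [← hbudget, ← integral_sub hV.integrable hgint, ← integral_const_mul]
      exact integral_add hUint ((hV.integrable.sub hgint).const_mul y)
    rw [hYval]
    nlinarith [hV.budget]

theorem IsOptimal.ae_eq_of_isBestResponse [IsProbabilityMeasure Q]
    (hg : IsBestResponse p.utility g s b) (hW : Measurable[ℱ p.T] (W p.T))
    (hζ : IsDiffuseDeflator Q (p.Z W p.T)) {y : ℝ} (hy : 0 < y)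
    (hbudget : ∫ ω, p.Z W p.T ω * g (y * p.Z W p.T ω) ∂Q = p.v₀)
    {V : Ω → ℝ} (hV : p.IsOptimal ℱ Q W V) : V =ᵐ[Q] fun ω => g (y * p.Z W p.T ω) := by
  have hUint := hg.integrable_utility (measurable_utility p) hζ hy
  have hgint := hg.integrable_mul hζ hy
  have hopt := isOptimal_of_isBestResponse hg hW hζ hy hbudget
  have hle := hV.optimal _ hopt.feasible
  rw [FundModel.extExpectation_eq_integral hV.integrable, FundModel.extExpectation_eq_integral hUint,
    EReal.coe_le_coe_iff] at hle
  -- The pointwise duality gap. It is nonnegative with nonpositive integral, hence zero almost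
  -- surely, and strict optimality away from the price `s` then forces equality.
  set D := fun ω => (p.utility (g (y * p.Z W p.T ω)) - p.utility (V ω))
      + y * (p.Z W p.T ω * V ω - p.Z W p.T ω * g (y * p.Z W p.T ω)) with hD
  have hi1 := hUint.sub hV.integrable
  have hi2 := (hV.feasible.integrable.sub hgint).const_mul y
  have hDint : Integrable D Q := hi1.add hi2
  have hDnn : 0 ≤ᵐ[Q] D := by
    filter_upwards [hV.feasible.nonneg] with ω hω
    have := hg.le _ _ (mul_pos hy (hζ.pos ω)) hω
    simp only [hD, Pi.zero_apply]; linarith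
  have hD0 : ∫ ω, D ω ∂Q = 0 := by
    refine le_antisymm ?_ (integral_nonneg_of_ae hDnn)
    have : ∫ ω, D ω ∂Q = (∫ ω, p.utility (g (y * p.Z W p.T ω)) ∂Q - ∫ ω, p.utility (V ω) ∂Q)
        + y * (∫ ω, p.Z W p.T ω * V ω ∂Q - p.v₀) := by
      rw [← hbudget, ← integral_sub hUint hV.integrable,
        ← integral_sub hV.feasible.integrable hgint, ← integral_const_mul]
      exact integral_add hi1 hi2
    rw [this]
    nlinarith [hV.feasible.budget]
  rw [integral_eq_zero_iff_of_nonneg_ae hDnn hDint] at hD0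
  have hns : ∀ᵐ ω ∂Q, p.Z W p.T ω ≠ s / y := by
    rw [ae_iff]; simpa using hζ.null (s / y)
  filter_upwards [hD0, hns, hV.feasible.nonneg] with ω h1 h2 h3
  by_contra hne
  have := hg.lt _ _ (mul_pos hy (hζ.pos ω)) h3
    (fun e => h2 (by rw [eq_div_iff hy.ne', mul_comm]; exact e)) hne
  simp only [hD, Pi.zero_apply] at h1
  linarith

/-- The terminal value is positive when `ζ < s / y` and zero when `ζ > s / y`; both events have
positive probability, so it is not almost surely constant. -/
theorem variance_pos_of_isBestResponse [IsProbabilityMeasure Q] (hg : IsBestResponse U g s b)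
    (hζ : IsDiffuseDeflator Q ζ) {y : ℝ} (hy : 0 < y) {V : Ω → ℝ}
    (hV : V =ᵐ[Q] fun ω => g (y * ζ ω)) (hL2 : MemLp V 2 Q) : 0 < variance V Q := by
  refine lt_of_le_of_ne (variance_nonneg V Q) fun h0 => ?_
  have h1 : evariance V Q = 0 := by
    rw [← hL2.ofReal_variance_eq, ← h0, ENNReal.ofReal_zero]
  rw [evariance_eq_zero_iff hL2.aestronglyMeasurable.aemeasurable] at h1
  have hc : ∀ᵐ ω ∂Q, g (y * ζ ω) = ∫ ω, V ω ∂Q := by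
    filter_upwards [h1, hV] with ω h h' using h'.symm.trans h
  have hsy : 0 < s / y := div_pos hg.s_pos hy
  obtain ⟨ω₁, h₁, h₁'⟩ : ∃ ω, (0 < ζ ω ∧ ζ ω < s / y) ∧ g (y * ζ ω) = ∫ ω, V ω ∂Q := by
    by_contra hno
    push Not at hno
    exact hζ.charge 0 (s / y) le_rfl hsy (measure_mono_null (fun ω hω => hno ω hω) (ae_iff.1 hc))
  obtain ⟨ω₂, h₂, h₂'⟩ : ∃ ω, (s / y < ζ ω ∧ ζ ω < s / y + 1) ∧ g (y * ζ ω) = ∫ ω, V ω ∂Q := by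
    by_contra hno
    push Not at hno
    exact hζ.charge (s / y) (s / y + 1) hsy.le (lt_add_one _)
      (measure_mono_null (fun ω hω => hno ω hω) (ae_iff.1 hc))
  have h3 := hg.pos_of_le (mul_pos hy h₁.1) (by
    have := (lt_div_iff₀ hy).1 h₁.2; linarith)
  have h4 := hg.eq_zero (y * ζ ω₂) (by have := (div_lt_iff₀ hy).1 h₂.1; linarith)
  linarith

end FundModel

end

/-! ### Truncated lognormal moments -/

noncomputable section

variable {Ω : Type*} {mΩ : MeasurableSpace Ω} {Q : Measure Ω}

/-- `f` is integrable with integral `v`. -/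
def HasExpectation (Q : Measure Ω) (f : Ω → ℝ) (v : ℝ) : Prop := Integrable f Q ∧ ∫ ω, f ω ∂Q = v

namespace HasExpectation

variable {f f' : Ω → ℝ} {v v' : ℝ}

lemma add (h : HasExpectation Q f v) (h' : HasExpectation Q f' v') :
    HasExpectation Q (fun ω => f ω + f' ω) (v + v') :=
  ⟨h.1.add h'.1, by rw [integral_add h.1 h'.1, h.2, h'.2]⟩

lemma sub (h : HasExpectation Q f v) (h' : HasExpectation Q f' v') :
    HasExpectation Q (fun ω => f ω - f' ω) (v - v') :=
  ⟨h.1.sub h'.1, by rw [integral_sub h.1 h'.1, h.2, h'.2]⟩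

lemma const_mul (h : HasExpectation Q f v) (c : ℝ) :
    HasExpectation Q (fun ω => c * f ω) (c * v) :=
  ⟨h.1.const_mul c, by rw [integral_const_mul, h.2]⟩

lemma congr (h : HasExpectation Q f v) (hf : f' =ᵐ[Q] f) (hv : v' = v) :
    HasExpectation Q f' v' :=
  ⟨h.1.congr hf.symm, by rw [integral_congr_ae hf, h.2, hv]⟩

end HasExpectation

lemma FundModel.Φ_coe (x : ℝ) : FundModel.Φ (x : EReal) = (gaussianReal 0 1).real (Iic x) := by
  simp only [FundModel.Φ, EReal.coe_le_coe_iff]; rfl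

lemma FundModel.Φ_top : FundModel.Φ ⊤ = 1 := by
  have : {u : ℝ | (u : EReal) ≤ ⊤} = univ := by ext; simp
  rw [FundModel.Φ, this, probReal_univ]

/-- Completing the square: exponential tilting by `t` moves the mean to `t`. -/
lemma gaussianPDFReal_mul_exp (t x : ℝ) :
    gaussianPDFReal 0 1 x * Real.exp (t * x) = Real.exp (t ^ 2 / 2) * gaussianPDFReal t 1 x := by
  simp only [gaussianPDFReal]
  rw [mul_assoc, ← Real.exp_add, mul_left_comm, ← Real.exp_add]
  congr 2
  simp; ring

/-- Upper partial exponential moments of the standard normal law. -/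
lemma integral_indicator_exp_gaussianReal (t e : ℝ) :
    ∫ x, (Ioi e).indicator (fun x => Real.exp (t * x)) x ∂(gaussianReal 0 1)
      = Real.exp (t ^ 2 / 2) * (1 - FundModel.Φ ((e - t : ℝ) : EReal)) := by
  have h1 : ∫ x, (Ioi e).indicator (fun x => Real.exp (t * x)) x ∂(gaussianReal 0 1)
      = Real.exp (t ^ 2 / 2) * ∫ x, (Ioi e).indicator (fun _ => (1 : ℝ)) x ∂(gaussianReal t 1) := by
    rw [integral_gaussianReal_eq_integral_smul one_ne_zero,
      integral_gaussianReal_eq_integral_smul one_ne_zero, ← integral_const_mul]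
    refine integral_congr_ae (.of_forall fun x => ?_)
    by_cases hx : x ∈ Ioi e
    · simp only [indicator_of_mem hx, smul_eq_mul, mul_one]
      exact gaussianPDFReal_mul_exp t x
    · simp [indicator_of_notMem hx]
  have h4 : ∫ x, (Ioi e).indicator (fun _ => (1 : ℝ)) x ∂(gaussianReal t 1)
      = (gaussianReal t 1).real (Ioi e) := integral_indicator_one measurableSet_Ioi
  rw [h1, h4]
  congr 1
  have h2 : gaussianReal t 1 = (gaussianReal 0 1).map (· + t) := by
    rw [gaussianReal_map_add_const, zero_add]
  have h3 : (· + t) ⁻¹' Ioi e = (Iic (e - t))ᶜ := by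
    ext x; simp [sub_lt_iff_lt_add]
  rw [h2, map_measureReal_apply (by fun_prop) measurableSet_Ioi, h3,
    probReal_compl_eq_one_sub measurableSet_Iic, FundModel.Φ_coe]

namespace FundModel

variable {p : FundModel} {ℱ : Filtration ℝ≥0 mΩ} {W : ℝ≥0 → Ω → ℝ}

lemma Admissible.γ_pos (hp : p.Admissible) : 0 < p.γ :=
  div_pos (sub_pos.2 hp.r_lt_μ) hp.σ_pos

lemma _root_.IsWienerOn.hasLaw {T : ℝ≥0} (hW : IsWienerOn T ℱ Q W) :
    HasLaw (W T) (gaussianReal 0 T) Q := by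
  have h := hW.gaussian_increments 0 T (zero_le) le_rfl
  rw [tsub_zero] at h
  refine h.congr ?_
  filter_upwards [hW.start_zero] with ω hω
  simp [hω]

lemma _root_.IsWienerOn.measurable {T : ℝ≥0} (hW : IsWienerOn T ℱ Q W) :
    Measurable (W T) := (hW.adapted T le_rfl).mono (ℱ.le T) le_rfl

lemma Z_rpow (p : FundModel) (k : ℝ) (ω : Ω) : p.Z W p.T ω ^ k
    = Real.exp (-k * ((p.r + p.γ ^ 2 / 2) * p.T)) * Real.exp (-k * p.γ * W p.T ω) := by
  rw [Z, ← Real.exp_mul, ← Real.exp_add]; congr 1; ring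

lemma Admissible.isDiffuseDeflator (hp : p.Admissible) (hW : IsWienerOn p.T ℱ Q W) :
    IsDiffuseDeflator Q (p.Z W p.T) := by
  have hX := hW.hasLaw
  have hT : p.T ≠ 0 := hp.T_pos.ne'
  have hγ := hp.γ_pos
  refine ⟨measurable_Z p hW.measurable, fun ω => Real.exp_pos _, fun k => ?_, fun x => ?_,
    fun x y hx hxy => ?_⟩
  · simp only [Z_rpow]
    refine Integrable.const_mul ?_ _
    refine Integrable.comp_aemeasurable (g := fun u => Real.exp (-k * p.γ * u)) ?_ hX.aemeasurable
    rw [hX.map_eq]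
    exact integrable_exp_mul_gaussianReal _
  · have := nullSingletonClass_gaussianReal (μ := 0) hT
    refine measure_mono_null (t := {ω | W p.T ω = (-(p.r + p.γ ^ 2 / 2) * p.T - Real.log x) / p.γ})
      ?_ ?_
    · rintro ω hω
      have : Real.log (p.Z W p.T ω) = Real.log x := by rw [hω]
      rw [Z, Real.log_exp] at this
      show W p.T ω = _
      rw [← this]; field_simp; ring
    · rw [hX.measure_eq (p := fun u => u = _) (measurableSet_singleton _)]
      exact measure_singleton _
  · have hO : IsOpen {u : ℝ | x < Real.exp (-(p.r + p.γ ^ 2 / 2) * p.T - p.γ * u) ∧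
        Real.exp (-(p.r + p.γ ^ 2 / 2) * p.T - p.γ * u) < y} :=
      (isOpen_lt (by fun_prop) (by fun_prop)).and (isOpen_lt (by fun_prop) (by fun_prop))
    have h1 := hX.measure_eq (p := fun u => x < Real.exp (-(p.r + p.γ ^ 2 / 2) * p.T - p.γ * u) ∧
        Real.exp (-(p.r + p.γ ^ 2 / 2) * p.T - p.γ * u) < y) hO.measurableSet
    intro h0
    -- Lebesgue measure is absolutely continuous with respect to the Gaussian law, so it suffices
    -- that the open set is nonempty; the witness makes the density equal to `(x + y) / 2`.
    have h2 := gaussianReal_absolutelyContinuous' 0 hT (h1.symm.trans h0)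
    refine (hO.measure_pos volume ?_).ne' h2
    refine ⟨(-(p.r + p.γ ^ 2 / 2) * p.T - Real.log ((x + y) / 2)) / p.γ, ?_⟩
    have h3 : -(p.r + p.γ ^ 2 / 2) * p.T
        - p.γ * ((-(p.r + p.γ ^ 2 / 2) * p.T - Real.log ((x + y) / 2)) / p.γ)
        = Real.log ((x + y) / 2) := by field_simp; ring
    rw [mem_ofPred_eq, h3, Real.exp_log (by linarith)]
    constructor <;> linarith

/-- The moment of order `k` of the state price density. -/
def densityMoment (p : FundModel) (k : ℝ) : ℝ :=
  Real.exp (-k * ((p.r + p.γ ^ 2 / 2) * p.T) + k ^ 2 * p.γ ^ 2 * p.T / 2)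

lemma densityMoment_zero (p : FundModel) : p.densityMoment 0 = 1 := by simp [densityMoment]

lemma densityMoment_neg_inv (p : FundModel) : p.densityMoment (-p.b⁻¹) = p.ξ₃ := by
  unfold densityMoment ξ₃; congr 1; ring

lemma densityMoment_neg_two_mul_inv (p : FundModel) :
    p.densityMoment (-2 * p.b⁻¹) = p.ξ₄ := by
  unfold densityMoment ξ₄; congr 1; ring

lemma ΔΦ_d₁ (p : FundModel) (x k : ℝ) :
    p.ΔΦ d₁ (x : EReal) k = 1 - Φ ((x + k * p.γ * √(p.T : ℝ) : ℝ) : EReal) := by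
  rw [ΔΦ, d₁, EReal.top_add_coe, Φ_top, ← EReal.coe_add]

/-- Every interval is a difference of two upper tails, the form in which truncated moments are
computed. -/
lemma ΔΦ_sub (p : FundModel) (x y : EReal) (k : ℝ) :
    p.ΔΦ x y k = p.ΔΦ d₁ y k - p.ΔΦ d₁ x k := by
  unfold ΔΦ; ring

/-- Truncated moments of the state price density. -/
lemma Admissible.hasExpectation_truncated (hp : p.Admissible) (hW : IsWienerOn p.T ℱ Q W)
    {x : ℝ} (hx : 0 < x) (k : ℝ) :
    HasExpectation Q (fun ω => {z | z < 1 / x}.indicator (fun z => z ^ k) (p.Z W p.T ω))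
      (p.densityMoment k * p.ΔΦ d₁ (p.d x : ℝ) k) := by
  have hζ := hp.isDiffuseDeflator hW
  have hγ := hp.γ_pos
  have hT : 0 < (p.T : ℝ) := hp.T_pos
  have hsT : 0 < √(p.T : ℝ) := Real.sqrt_pos.2 hT
  have hG : HasLaw (fun ω => W p.T ω / √(p.T : ℝ)) (gaussianReal 0 1) Q := by
    have h := gaussianReal_div_const hW.hasLaw (√(p.T : ℝ))
    convert h using 2
    · simp
    · apply NNReal.eq
      simp only [NNReal.coe_one, NNReal.coe_div, NNReal.coe_mk, Real.sq_sqrt hT.le]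
      rw [div_self hT.ne']
  -- As `γ > 0`, the density decreases in `W`, so small densities are an upper tail of the
  -- standardized Wiener value.
  have hmem : ∀ ω, p.Z W p.T ω < 1 / x ↔ p.d x < W p.T ω / √(p.T : ℝ) := by
    intro ω
    rw [← Real.log_lt_log_iff (hζ.pos ω) (by positivity), Z, Real.log_exp, d, one_div,
      Real.log_inv, div_lt_div_iff₀ (by positivity) hsT]
    have : W p.T ω * (p.γ * √(p.T : ℝ)) = (p.γ * W p.T ω) * √(p.T : ℝ) := by ring
    rw [this, mul_lt_mul_iff_left₀ hsT]
    constructor <;> intro h <;> linarith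
  refine ⟨?_, ?_⟩
  · refine (hζ.integrable_rpow k).mono' ?_ (.of_forall fun ω => ?_)
    · exact ((Measurable.indicator (by fun_prop)
        (measurableSet_lt measurable_id measurable_const)).comp hζ.measurable).aestronglyMeasurable
    · have := Real.rpow_nonneg (hζ.pos ω).le k
      simp only [indicator]
      split_ifs
      · rw [Real.norm_eq_abs, abs_of_nonneg this]
      · simpa using this
  · have h1 : ∀ ω, {z | z < 1 / x}.indicator (fun z => z ^ k) (p.Z W p.T ω)
        = Real.exp (-k * ((p.r + p.γ ^ 2 / 2) * p.T)) * (Ioi (p.d x)).indicator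
          (fun u => Real.exp (-k * p.γ * √(p.T : ℝ) * u)) (W p.T ω / √(p.T : ℝ)) := by
      intro ω
      simp only [indicator, mem_ofPred_eq, mem_Ioi, hmem ω]
      split_ifs
      · rw [Z_rpow]
        congr 2
        field_simp
      · simp
    have h2 := hG.integral_comp (f :=
      (Ioi (p.d x)).indicator (fun u => Real.exp (-k * p.γ * √(p.T : ℝ) * u)))
      (Measurable.indicator (by fun_prop) measurableSet_Ioi).aestronglyMeasurable
    simp only [Function.comp_def] at h2
    simp_rw [h1]
    -- The tilt is `-k * γ * √T`; subtracting it produces the shift `+ k * γ * √T` in `ΔΦ`.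
    rw [integral_const_mul, h2, integral_indicator_exp_gaussianReal, ΔΦ_d₁, densityMoment, Real.exp_add, ← mul_assoc]
    congr 3
    · rw [mul_pow, mul_pow, Real.sq_sqrt hT.le]; ring
    · congr 3; ring

/-- Moments of a terminal value which is, as a function of `x = y * Z_T`, of the form
`A x ^ q + D`, `K`, `A' x ^ q + D'` and `0` on consecutive intervals. -/
lemma Admissible.hasMoments_of_piecewise (hp : p.Admissible) (hW : IsWienerOn p.T ℱ Q W)
    {y t₁ t₂ t₃ A D K A' D' q : ℝ} {g : ℝ → ℝ} {V : Ω → ℝ} (hy : 0 < y) (ht₁ : 0 < t₁)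
    (h12 : t₁ ≤ t₂) (h23 : t₂ ≤ t₃) (hV : V =ᵐ[Q] fun ω => g (y * p.Z W p.T ω))
    (h1 : ∀ x, 0 < x → x < t₁ → g x = A * x ^ q + D)
    (h2 : ∀ x, t₁ < x → x < t₂ → g x = K)
    (h3 : ∀ x, t₂ < x → x < t₃ → g x = A' * x ^ q + D')
    (h4 : ∀ x, t₃ < x → g x = 0) :
    HasMoments Q V
      (A * y ^ q * p.densityMoment q * p.ΔΦ d₁ (p.d (y / t₁) : ℝ) q
        + D * p.ΔΦ d₁ (p.d (y / t₁) : ℝ) 0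
        + K * p.ΔΦ (p.d (y / t₁) : ℝ) (p.d (y / t₂) : ℝ) 0
        + A' * y ^ q * p.densityMoment q * p.ΔΦ (p.d (y / t₂) : ℝ) (p.d (y / t₃) : ℝ) q
        + D' * p.ΔΦ (p.d (y / t₂) : ℝ) (p.d (y / t₃) : ℝ) 0)
      ((A * y ^ q) ^ 2 * p.densityMoment (2 * q) * p.ΔΦ d₁ (p.d (y / t₁) : ℝ) (2 * q)
        + 2 * (A * y ^ q) * D * p.densityMoment q * p.ΔΦ d₁ (p.d (y / t₁) : ℝ) q
        + D ^ 2 * p.ΔΦ d₁ (p.d (y / t₁) : ℝ) 0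
        + K ^ 2 * p.ΔΦ (p.d (y / t₁) : ℝ) (p.d (y / t₂) : ℝ) 0
        + (A' * y ^ q) ^ 2 * p.densityMoment (2 * q)
          * p.ΔΦ (p.d (y / t₂) : ℝ) (p.d (y / t₃) : ℝ) (2 * q)
        + 2 * (A' * y ^ q) * D' * p.densityMoment q
          * p.ΔΦ (p.d (y / t₂) : ℝ) (p.d (y / t₃) : ℝ) q
        + D' ^ 2 * p.ΔΦ (p.d (y / t₂) : ℝ) (p.d (y / t₃) : ℝ) 0) := by
  have hζ := hp.isDiffuseDeflator hW
  have ht₂ := ht₁.trans_le h12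
  have ht₃ := ht₂.trans_le h23
  have e1 : ∀ k, _ := fun k => hp.hasExpectation_truncated hW (div_pos hy ht₁) k
  have e2 : ∀ k, _ := fun k => hp.hasExpectation_truncated hW (div_pos hy ht₂) k
  have e3 : ∀ k, _ := fun k => hp.hasExpectation_truncated hW (div_pos hy ht₃) k
  have hne : ∀ t, ∀ᵐ ω ∂Q, p.Z W p.T ω ≠ t := fun t => by
    rw [ae_iff]; simpa using hζ.null t
  have hlt : ∀ {t} ω, 0 < t → (p.Z W p.T ω < 1 / (y / t) ↔ y * p.Z W p.T ω < t) := by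
    intro t ω ht
    rw [one_div_div, lt_div_iff₀ hy, mul_comm]
  have hne' : ∀ t, ∀ᵐ ω ∂Q, y * p.Z W p.T ω ≠ t := fun t => by
    filter_upwards [hne (t / y)] with ω hω h
    exact hω (by rw [← h]; field_simp)
  -- Indicators of intervals become differences of half-line indicators. Squaring creates no cross
  -- terms between pieces, as these are disjoint; the breakpoints form a null set.
  have key : ∀ᵐ ω ∂Q,
      V ω = A * y ^ q * {z | z < 1 / (y / t₁)}.indicator (fun z => z ^ q) (p.Z W p.T ω)
        + D * {z | z < 1 / (y / t₁)}.indicator (fun z => z ^ (0 : ℝ)) (p.Z W p.T ω)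
        + K * ({z | z < 1 / (y / t₂)}.indicator (fun z => z ^ (0 : ℝ)) (p.Z W p.T ω)
          - {z | z < 1 / (y / t₁)}.indicator (fun z => z ^ (0 : ℝ)) (p.Z W p.T ω))
        + A' * y ^ q * ({z | z < 1 / (y / t₃)}.indicator (fun z => z ^ q) (p.Z W p.T ω)
          - {z | z < 1 / (y / t₂)}.indicator (fun z => z ^ q) (p.Z W p.T ω))
        + D' * ({z | z < 1 / (y / t₃)}.indicator (fun z => z ^ (0 : ℝ)) (p.Z W p.T ω)
          - {z | z < 1 / (y / t₂)}.indicator (fun z => z ^ (0 : ℝ)) (p.Z W p.T ω)) ∧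
      V ω ^ 2 = (A * y ^ q) ^ 2
          * {z | z < 1 / (y / t₁)}.indicator (fun z => z ^ (2 * q)) (p.Z W p.T ω)
        + 2 * (A * y ^ q) * D * {z | z < 1 / (y / t₁)}.indicator (fun z => z ^ q) (p.Z W p.T ω)
        + D ^ 2 * {z | z < 1 / (y / t₁)}.indicator (fun z => z ^ (0 : ℝ)) (p.Z W p.T ω)
        + K ^ 2 * ({z | z < 1 / (y / t₂)}.indicator (fun z => z ^ (0 : ℝ)) (p.Z W p.T ω)
          - {z | z < 1 / (y / t₁)}.indicator (fun z => z ^ (0 : ℝ)) (p.Z W p.T ω))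
        + (A' * y ^ q) ^ 2
          * ({z | z < 1 / (y / t₃)}.indicator (fun z => z ^ (2 * q)) (p.Z W p.T ω)
            - {z | z < 1 / (y / t₂)}.indicator (fun z => z ^ (2 * q)) (p.Z W p.T ω))
        + 2 * (A' * y ^ q) * D'
          * ({z | z < 1 / (y / t₃)}.indicator (fun z => z ^ q) (p.Z W p.T ω)
            - {z | z < 1 / (y / t₂)}.indicator (fun z => z ^ q) (p.Z W p.T ω))
        + D' ^ 2 * ({z | z < 1 / (y / t₃)}.indicator (fun z => z ^ (0 : ℝ)) (p.Z W p.T ω)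
          - {z | z < 1 / (y / t₂)}.indicator (fun z => z ^ (0 : ℝ)) (p.Z W p.T ω)) := by
    filter_upwards [hV, hne' t₁, hne' t₂, hne' t₃] with ω hVω n1 n2 n3
    have hz := hζ.pos ω
    have hx := mul_pos hy hz
    have hsq : p.Z W p.T ω ^ (2 * q) = (p.Z W p.T ω ^ q) ^ 2 := by
      rw [mul_comm, Real.rpow_mul hz.le]; norm_cast
    simp only [indicator, mem_ofPred_eq, hlt ω ht₁, hlt ω ht₂, hlt ω ht₃, Real.rpow_zero, hsq]
    rw [hVω]
    rcases lt_or_gt_of_ne n1 with c1 | c1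
    · have c2 := c1.trans_le h12
      have c3 := c2.trans_le h23
      rw [h1 _ hx c1, Real.mul_rpow hy.le hz.le]
      simp only [c1, c2, c3, if_true]
      constructor <;> ring
    · rcases lt_or_gt_of_ne n2 with c2 | c2
      · have c3 := c2.trans_le h23
        rw [h2 _ c1 c2]
        simp only [c1.not_gt, c2, c3, if_true, if_false]
        constructor <;> ring
      · rcases lt_or_gt_of_ne n3 with c3 | c3
        · rw [h3 _ c2 c3, Real.mul_rpow hy.le hz.le]
          simp only [c1.not_gt, c2.not_gt, c3, if_true, if_false]
          constructor <;> ring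
        · rw [h4 _ c3]
          simp only [c1.not_gt, c2.not_gt, c3.not_gt, if_false]
          constructor <;> ring
  have m1 := ((((((e1 q).const_mul (A * y ^ q)).add ((e1 0).const_mul D)).add
    (((e2 0).sub (e1 0)).const_mul K)).add (((e3 q).sub (e2 q)).const_mul (A' * y ^ q))).add
    (((e3 0).sub (e2 0)).const_mul D')).congr (key.mono fun ω h => h.1) rfl
  have m2 := ((((((((e1 (2 * q)).const_mul ((A * y ^ q) ^ 2)).add
    ((e1 q).const_mul (2 * (A * y ^ q) * D))).add ((e1 0).const_mul (D ^ 2))).add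
    (((e2 0).sub (e1 0)).const_mul (K ^ 2))).add
    (((e3 (2 * q)).sub (e2 (2 * q))).const_mul ((A' * y ^ q) ^ 2))).add
    (((e3 q).sub (e2 q)).const_mul (2 * (A' * y ^ q) * D'))).add
    (((e3 0).sub (e2 0)).const_mul (D' ^ 2))).congr (key.mono fun ω h => h.2) rfl
  refine ⟨m1.1, m2.1, m1.2.trans ?_, m2.2.trans ?_⟩
  · simp only [ΔΦ_sub p (p.d (y / t₁) : ℝ), ΔΦ_sub p (p.d (y / t₂) : ℝ), densityMoment_zero]
    ring
  · simp only [ΔΦ_sub p (p.d (y / t₁) : ℝ), ΔΦ_sub p (p.d (y / t₂) : ℝ), densityMoment_zero]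
    ring

end FundModel

end

/-! ### Moments in the three cases and the Sharpe ratio -/

noncomputable section

variable {Ω : Type*} {mΩ : MeasurableSpace Ω} {Q : Measure Ω} {ζ : Ω → ℝ} {U g : ℝ → ℝ} {s b : ℝ}

lemma IsBestResponse.memLp (hg : IsBestResponse U g s b) [IsProbabilityMeasure Q]
    (hζ : IsDiffuseDeflator Q ζ) {y : ℝ} (hy : 0 < y) : MemLp (fun ω => g (y * ζ ω)) 2 Q := by
  obtain ⟨C, hC⟩ := hg.abs_le_growth (ζ := ζ)
  have h1 : MemLp (fun ω => ζ ω ^ (-1 / b)) 2 Q := by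
    refine (memLp_two_iff_integrable_sq
      (hζ.measurable.pow_const _).aestronglyMeasurable).2 ?_
    refine (hζ.integrable_rpow (-1 / b * 2)).congr (.of_forall fun ω => ?_)
    simp only [Real.rpow_mul (hζ.pos ω).le, Real.rpow_two]
  have h2 : MemLp (fun ω => C * (1 + y ^ (-1 / b) * ζ ω ^ (-1 / b))) 2 Q :=
    ((memLp_const (1 : ℝ)).add (h1.const_mul (y ^ (-1 / b)))).const_mul C
  refine h2.mono' (f := fun ω => g (y * ζ ω)) (hg.measurable.comp (hζ.measurable.const_mul y)).aestronglyMeasurable ?_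
  exact .of_forall fun ω => hC y ω hy (hζ.pos ω)

namespace FundModel

variable {p : FundModel} {ℱ : Filtration ℝ≥0 mΩ} {W : ℝ≥0 → Ω → ℝ}

theorem _root_.IsBestResponse.multiplier [IsProbabilityMeasure Q] {v : ℝ → ℝ → ℝ}
    (hg : IsBestResponse p.utility g s b) (hp : p.Admissible) (hW : Measurable[ℱ p.T] (W p.T))
    (hζ : IsDiffuseDeflator Q (p.Z W p.T)) (hv : ∀ y, 0 < y → ∀ z, v y z = g (y * z)) :
    (∃! y, p.IsMultiplier Q W v y) ∧ ∀ y, p.IsMultiplier Q W v y →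
      p.IsOptimal ℱ Q W (fun ω => v y (p.Z W p.T ω)) ∧
      ∀ V, p.IsOptimal ℱ Q W V → V =ᵐ[Q] fun ω => g (y * p.Z W p.T ω) := by
  have hiff : ∀ y, p.IsMultiplier Q W v y ↔
      0 < y ∧ ∫ ω, p.Z W p.T ω * g (y * p.Z W p.T ω) ∂Q = p.v₀ := fun y =>
    and_congr_right fun hy => by simp only [hv y hy]
  refine ⟨?_, fun y hy => ?_⟩
  · simp only [hiff]
    exact hg.existsUnique_multiplier hζ hp.v₀_pos
  · obtain ⟨hy0, hbudget⟩ := (hiff y).1 hy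
    simp only [hv y hy0]
    exact ⟨isOptimal_of_isBestResponse hg hW hζ hy0 hbudget,
      fun V hV => hV.ae_eq_of_isBestResponse hg hW hζ hy0 hbudget⟩

/-- The three cases are exhaustive, so the variance and Sharpe ratio claims can be proved without
distinguishing them. -/
lemma Admissible.exists_isBestResponse (hp : p.Admissible) :
    ∃ g s, IsBestResponse p.utility g s p.b := by
  by_cases hN : p.m * p.v₀ + p.a = 0
  · obtain ⟨θ, hθ, -⟩ := hp.existsUnique_thetaA (Or.inl hN)
    exact ⟨_, _, hp.isBestResponse_valueA hθ⟩
  rcases lt_or_ge p.H (p.α * p.κ) with h | h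
  · obtain ⟨θ, hθ, -⟩ := hp.existsUnique_thetaA (Or.inr h)
    exact ⟨_, _, hp.isBestResponse_valueA hθ⟩
  rcases le_or_gt p.H p.κ with h' | h'
  · exact ⟨_, _, hp.isBestResponse_valueB ⟨hN, h, h'⟩⟩
  · obtain ⟨θ, hθ, -⟩ := hp.existsUnique_thetaC ⟨hN, h'⟩
    exact ⟨_, _, hp.isBestResponse_valueC ⟨hN, h'⟩ hθ⟩

lemma sharpeRatio_eq [IsProbabilityMeasure Q] (hv : 0 < p.v₀) {V : Ω → ℝ} (hV : MemLp V 2 Q) :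
    p.sharpeRatio Q V = ((∫ ω, V ω ∂Q) - p.v₀ * (1 + p.r))
      / √((∫ ω, V ω ^ 2 ∂Q) - (∫ ω, V ω ∂Q) ^ 2) := by
  have hint : Integrable V Q := hV.integrable one_le_two
  have h1 : ∫ ω, (V ω - p.v₀) / p.v₀ ∂Q = (∫ ω, V ω ∂Q - p.v₀) / p.v₀ := by
    rw [integral_div, integral_sub hint (integrable_const _)]; simp
  have h2 : variance (fun ω => (V ω - p.v₀) / p.v₀) Q
      = ((∫ ω, V ω ^ 2 ∂Q) - (∫ ω, V ω ∂Q) ^ 2) / p.v₀ ^ 2 := by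
    have e : (fun ω => (V ω - p.v₀) / p.v₀) = fun ω => p.v₀⁻¹ * (V ω + -p.v₀) := by
      ext ω; rw [div_eq_inv_mul, sub_eq_add_neg]
    rw [e, variance_const_mul, variance_add_const hV.aestronglyMeasurable, variance_eq_sub hV,
      inv_pow, div_eq_inv_mul]
    rfl
  rw [sharpeRatio, h1, h2, Real.sqrt_div' _ (sq_nonneg _), Real.sqrt_sq hv.le]
  rw [show (∫ ω, V ω ∂Q - p.v₀) / p.v₀ - p.r = (∫ ω, V ω ∂Q - p.v₀ * (1 + p.r)) / p.v₀ by
    field_simp; ring, div_div_div_cancel_right₀ hv.ne']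

lemma rpow_neg_two_div {x b : ℝ} (hx : 0 < x) : x ^ (-2 / b) = (x ^ (-b⁻¹)) ^ 2 := by
  rw [← Real.rpow_mul_natCast hx.le]; congr 1; push_cast; ring

lemma Admissible.α_rpow (hp : p.Admissible) :
    p.α ^ ((2 - 2 * p.b) / p.b) = (p.α ^ (1 / p.b - 1)) ^ 2 := by
  have := hp.b_pos.ne'
  rw [← Real.rpow_mul_natCast hp.α_mem.1.le]; congr 1; push_cast; field_simp

lemma Admissible.α_rpow' (hp : p.Admissible) :
    p.α ^ ((1 - p.b) / p.b) = p.α ^ (1 / p.b - 1) := by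
  have := hp.b_pos.ne'
  congr 1; field_simp

lemma densityMoment_two_mul (p : FundModel) : p.densityMoment (2 * -p.b⁻¹) = p.ξ₄ := by
  rw [← densityMoment_neg_two_mul_inv]; congr 1; ring

lemma div_mul_κ (hN : 0 < p.midWealth) (y : ℝ) :
    y * p.α⁻¹ * (p.m * p.v₀ + p.a) ^ p.b = y / (p.α * p.κ) := by
  have : p.κ = (p.midWealth ^ p.b)⁻¹ := Real.rpow_neg hN.le _
  rw [this, show p.m * p.v₀ + p.a = p.midWealth from rfl, div_eq_mul_inv, mul_inv, inv_inv]; ring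

lemma div_κ (hN : 0 < p.midWealth) (y : ℝ) :
    y * (p.m * p.v₀ + p.a) ^ p.b = y / p.κ := by
  have : p.κ = (p.midWealth ^ p.b)⁻¹ := Real.rpow_neg hN.le _
  rw [this, show p.m * p.v₀ + p.a = p.midWealth from rfl, div_eq_mul_inv, inv_inv]

section Moments

variable {y θ : ℝ} {V : Ω → ℝ}

lemma Admissible.hasMoments_valueA (hp : p.Admissible) (hW : IsWienerOn p.T ℱ Q W)
    (hθ : p.IsThetaA θ) (hy : 0 < y) (hV : V =ᵐ[Q] fun ω => p.valueA θ 1 (y * p.Z W p.T ω)) :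
    HasMoments Q V
      (y ^ (-1 / p.b) * p.α ^ ((1 - p.b) / p.b) * p.ξ₃ * p.ΔΦ d₁ (p.d₂A θ y) (-p.b⁻¹)
        + p.L * p.ΔΦ d₁ (p.d₂A θ y) 0)
      (p.α ^ ((2 - 2 * p.b) / p.b) * y ^ (-2 / p.b) * p.ξ₄
          * p.ΔΦ d₁ (p.d₂A θ y) (-2 * p.b⁻¹)
        + 2 * p.α ^ ((1 - p.b) / p.b) * y ^ (-1 / p.b) * p.L * p.ξ₃
          * p.ΔΦ d₁ (p.d₂A θ y) (-p.b⁻¹)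
        + p.L ^ 2 * p.ΔΦ d₁ (p.d₂A θ y) 0) := by
  have hs0 := (hp.isBestResponse_valueA hθ).s_pos
  -- All three breakpoints equal `slopeA θ`, so the middle pieces are empty.
  have h := hp.hasMoments_of_piecewise hW (A := p.α ^ (1 / p.b - 1)) (D := p.L) (K := 0)
    (A' := 0) (D' := 0) (q := -p.b⁻¹) hy hs0 le_rfl le_rfl hV
    (fun x hx hxs => by rw [valueA_of_le θ hx hxs.le, neg_div, one_div])
    (fun x hx hx' => absurd hx hx'.not_gt) (fun x hx hx' => absurd hx hx'.not_gt)
    (fun x hx => valueA_of_gt θ hx)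
  rw [densityMoment_two_mul, densityMoment_neg_inv, show 2 * -p.b⁻¹ = -2 * p.b⁻¹ by ring] at h
  rw [rpow_neg_two_div hy, hp.α_rpow, hp.α_rpow', show -1 / p.b = -p.b⁻¹ by ring, d₂A]
  convert h using 1 <;> ring

lemma Admissible.hasMoments_valueB (hp : p.Admissible) (hW : IsWienerOn p.T ℱ Q W)
    (hB : p.CaseB) (hy : 0 < y) (hV : V =ᵐ[Q] fun ω => p.valueB 1 (y * p.Z W p.T ω)) :
    HasMoments Q V
      (y ^ (-1 / p.b) * p.α ^ ((1 - p.b) / p.b) * p.ξ₃ * p.ΔΦ d₁ (p.d₂B y) (-p.b⁻¹)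
        + p.L * p.ΔΦ d₁ (p.d₂B y) 0
        + (1 + p.m) * p.v₀ * p.ΔΦ (p.d₂B y) (p.d₃B y) 0)
      (p.α ^ ((2 - 2 * p.b) / p.b) * y ^ (-2 / p.b) * p.ξ₄
          * p.ΔΦ d₁ (p.d₂B y) (-2 * p.b⁻¹)
        + 2 * p.α ^ ((1 - p.b) / p.b) * y ^ (-1 / p.b) * p.L * p.ξ₃
          * p.ΔΦ d₁ (p.d₂B y) (-p.b⁻¹)
        + p.L ^ 2 * p.ΔΦ d₁ (p.d₂B y) 0
        + (1 + p.m) ^ 2 * p.v₀ ^ 2 * p.ΔΦ (p.d₂B y) (p.d₃B y) 0) := by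
  have hN := hp.midWealth_pos hB.1
  have hακ : 0 < p.α * p.κ := mul_pos hp.α_mem.1 (Real.rpow_pos_of_pos hN _)
  -- The last two breakpoints coincide at `H`, which empties the third piece.
  have h := hp.hasMoments_of_piecewise hW (A := p.α ^ (1 / p.b - 1)) (D := p.L)
    (K := (1 + p.m) * p.v₀) (A' := 0) (D' := 0) (q := -p.b⁻¹) hy hακ hB.2.1 le_rfl hV
    (fun x hx hxs => by rw [valueB_of_lt hx hxs, neg_div, one_div])
    (fun x hx hx' => valueB_of_mid hx.le hx'.le) (fun x hx hx' => absurd hx hx'.not_gt)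
    (fun x hx => valueB_of_gt hB.2.1 hx)
  rw [densityMoment_two_mul, densityMoment_neg_inv, show 2 * -p.b⁻¹ = -2 * p.b⁻¹ by ring] at h
  rw [rpow_neg_two_div hy, hp.α_rpow, hp.α_rpow', show -1 / p.b = -p.b⁻¹ by ring, d₂B, d₃B,
    div_mul_κ hN]
  convert h using 1 <;> ring

lemma Admissible.hasMoments_valueC (hp : p.Admissible) (hW : IsWienerOn p.T ℱ Q W)
    (hC : p.CaseC) (hθ : p.IsThetaC θ) (hy : 0 < y)
    (hV : V =ᵐ[Q] fun ω => p.valueC θ 1 (y * p.Z W p.T ω)) :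
    HasMoments Q V
      (y ^ (-1 / p.b) * p.α ^ ((1 - p.b) / p.b) * p.ξ₃ * p.ΔΦ d₁ (p.d₂C y) (-p.b⁻¹)
        + p.L * p.ΔΦ d₁ (p.d₂C y) 0
        + (1 + p.m) * p.v₀ * p.ΔΦ (p.d₂C y) (p.d₃C y) 0
        + y ^ (-1 / p.b) * p.ξ₃ * p.ΔΦ (p.d₃C y) (p.d₄C θ y) (-p.b⁻¹)
        + (p.v₀ - p.a) * p.ΔΦ (p.d₃C y) (p.d₄C θ y) 0)
      (p.α ^ ((2 - 2 * p.b) / p.b) * y ^ (-2 / p.b) * p.ξ₄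
          * p.ΔΦ d₁ (p.d₂C y) (-2 * p.b⁻¹)
        + 2 * p.α ^ ((1 - p.b) / p.b) * y ^ (-1 / p.b) * p.L * p.ξ₃
          * p.ΔΦ d₁ (p.d₂C y) (-p.b⁻¹)
        + p.L ^ 2 * p.ΔΦ d₁ (p.d₂C y) 0
        + (1 + p.m) ^ 2 * p.v₀ ^ 2 * p.ΔΦ (p.d₂C y) (p.d₃C y) 0
        + y ^ (-2 / p.b) * p.ξ₄ * p.ΔΦ (p.d₃C y) (p.d₄C θ y) (-2 * p.b⁻¹)
        + 2 * y ^ (-1 / p.b) * (p.v₀ - p.a) * p.ξ₃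
          * p.ΔΦ (p.d₃C y) (p.d₄C θ y) (-p.b⁻¹)
        + (p.v₀ - p.a) ^ 2 * p.ΔΦ (p.d₃C y) (p.d₄C θ y) 0) := by
  have hN := hp.midWealth_pos hC.1
  have hκ : 0 < p.κ := Real.rpow_pos_of_pos hN _
  have hακ : 0 < p.α * p.κ := mul_pos hp.α_mem.1 hκ
  have h1 : p.α * p.κ ≤ p.κ := mul_le_of_le_one_left hκ.le hp.α_mem.2
  have h2 := hp.κ_lt_slopeC hθ
  have h := hp.hasMoments_of_piecewise hW (A := p.α ^ (1 / p.b - 1)) (D := p.L)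
    (K := (1 + p.m) * p.v₀) (A' := 1) (D' := p.v₀ - p.a) (q := -p.b⁻¹) hy hακ h1 h2.le hV
    (fun x hx hxs => by rw [valueC_of_lt θ h1 hx hxs, neg_div, one_div])
    (fun x hx hx' => valueC_of_kink θ hx.le hx'.le)
    (fun x hx hx' => by rw [valueC_of_mid θ h1 hx hx'.le, neg_div, one_div]; ring)
    (fun x hx => valueC_of_gt θ h1 h2 hx)
  rw [densityMoment_two_mul, densityMoment_neg_inv, show 2 * -p.b⁻¹ = -2 * p.b⁻¹ by ring] at h
  rw [rpow_neg_two_div hy, hp.α_rpow, hp.α_rpow', show -1 / p.b = -p.b⁻¹ by ring, d₂C, d₃C, d₄C,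
    div_mul_κ hN, div_κ hN]
  convert h using 1 <;> ring

end Moments

end FundModel

end

theorem mainTheorem7 {Ω : Type*} {mΩ : MeasurableSpace Ω} (Q : Measure Ω) [IsProbabilityMeasure Q]
    (ℱ : Filtration ℝ≥0 mΩ) (W : ℝ≥0 → Ω → ℝ) (p : FundModel) (hp : p.Admissible)
    (hW : IsWienerOn p.T ℱ Q W) :
    -- Case A
    (p.CaseA →
      (∃! θ, p.IsThetaA θ) ∧
      ∀ θ, p.IsThetaA θ →
        (∃! y, p.IsMultiplier Q W (p.valueA θ) y) ∧
        ∀ y, p.IsMultiplier Q W (p.valueA θ) y →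
          p.IsOptimal ℱ Q W (fun ω => p.valueA θ y (p.Z W p.T ω)) ∧
          ∀ V, p.IsOptimal ℱ Q W V →
            FundModel.HasMoments Q V
              (y ^ (-1 / p.b) * p.α ^ ((1 - p.b) / p.b) * p.ξ₃ * p.ΔΦ FundModel.d₁ (p.d₂A θ y) (-p.b⁻¹)
                + p.L * p.ΔΦ FundModel.d₁ (p.d₂A θ y) 0)
              (p.α ^ ((2 - 2 * p.b) / p.b) * y ^ (-2 / p.b) * p.ξ₄
                  * p.ΔΦ FundModel.d₁ (p.d₂A θ y) (-2 * p.b⁻¹)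
                + 2 * p.α ^ ((1 - p.b) / p.b) * y ^ (-1 / p.b) * p.L * p.ξ₃
                  * p.ΔΦ FundModel.d₁ (p.d₂A θ y) (-p.b⁻¹)
                + p.L ^ 2 * p.ΔΦ FundModel.d₁ (p.d₂A θ y) 0)) ∧
    -- Case B
    (p.CaseB →
      (∃! y, p.IsMultiplier Q W p.valueB y) ∧
      ∀ y, p.IsMultiplier Q W p.valueB y →
        p.IsOptimal ℱ Q W (fun ω => p.valueB y (p.Z W p.T ω)) ∧
        ∀ V, p.IsOptimal ℱ Q W V →
          FundModel.HasMoments Q V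
            (y ^ (-1 / p.b) * p.α ^ ((1 - p.b) / p.b) * p.ξ₃ * p.ΔΦ FundModel.d₁ (p.d₂B y) (-p.b⁻¹)
              + p.L * p.ΔΦ FundModel.d₁ (p.d₂B y) 0
              + (1 + p.m) * p.v₀ * p.ΔΦ (p.d₂B y) (p.d₃B y) 0)
            (p.α ^ ((2 - 2 * p.b) / p.b) * y ^ (-2 / p.b) * p.ξ₄
                * p.ΔΦ FundModel.d₁ (p.d₂B y) (-2 * p.b⁻¹)
              + 2 * p.α ^ ((1 - p.b) / p.b) * y ^ (-1 / p.b) * p.L * p.ξ₃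
                * p.ΔΦ FundModel.d₁ (p.d₂B y) (-p.b⁻¹)
              + p.L ^ 2 * p.ΔΦ FundModel.d₁ (p.d₂B y) 0
              + (1 + p.m) ^ 2 * p.v₀ ^ 2 * p.ΔΦ (p.d₂B y) (p.d₃B y) 0)) ∧
    -- Case C
    (p.CaseC →
      (∃! θ, p.IsThetaC θ) ∧
      ∀ θ, p.IsThetaC θ →
        (∃! y, p.IsMultiplier Q W (p.valueC θ) y) ∧
        ∀ y, p.IsMultiplier Q W (p.valueC θ) y →
          p.IsOptimal ℱ Q W (fun ω => p.valueC θ y (p.Z W p.T ω)) ∧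
          ∀ V, p.IsOptimal ℱ Q W V →
            FundModel.HasMoments Q V
              (y ^ (-1 / p.b) * p.α ^ ((1 - p.b) / p.b) * p.ξ₃ * p.ΔΦ FundModel.d₁ (p.d₂C y) (-p.b⁻¹)
                + p.L * p.ΔΦ FundModel.d₁ (p.d₂C y) 0
                + (1 + p.m) * p.v₀ * p.ΔΦ (p.d₂C y) (p.d₃C y) 0
                + y ^ (-1 / p.b) * p.ξ₃ * p.ΔΦ (p.d₃C y) (p.d₄C θ y) (-p.b⁻¹)
                + (p.v₀ - p.a) * p.ΔΦ (p.d₃C y) (p.d₄C θ y) 0)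
              (p.α ^ ((2 - 2 * p.b) / p.b) * y ^ (-2 / p.b) * p.ξ₄
                  * p.ΔΦ FundModel.d₁ (p.d₂C y) (-2 * p.b⁻¹)
                + 2 * p.α ^ ((1 - p.b) / p.b) * y ^ (-1 / p.b) * p.L * p.ξ₃
                  * p.ΔΦ FundModel.d₁ (p.d₂C y) (-p.b⁻¹)
                + p.L ^ 2 * p.ΔΦ FundModel.d₁ (p.d₂C y) 0
                + (1 + p.m) ^ 2 * p.v₀ ^ 2 * p.ΔΦ (p.d₂C y) (p.d₃C y) 0
                + y ^ (-2 / p.b) * p.ξ₄ * p.ΔΦ (p.d₃C y) (p.d₄C θ y) (-2 * p.b⁻¹)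
                + 2 * y ^ (-1 / p.b) * (p.v₀ - p.a) * p.ξ₃
                  * p.ΔΦ (p.d₃C y) (p.d₄C θ y) (-p.b⁻¹)
                + (p.v₀ - p.a) ^ 2 * p.ΔΦ (p.d₃C y) (p.d₄C θ y) 0)) ∧
    -- Sharpe ratio of the fund through the two moments
    (∀ V, p.IsOptimal ℱ Q W V →
      0 < variance V Q ∧
      p.sharpeRatio Q V =
        ((∫ ω, V ω ∂Q) - p.v₀ * (1 + p.r))
          / √((∫ ω, V ω ^ 2 ∂Q) - (∫ ω, V ω ∂Q) ^ 2)) := by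
  have hmeas := hW.adapted p.T le_rfl
  have hζ := hp.isDiffuseDeflator hW
  refine ⟨fun hA => ⟨hp.existsUnique_thetaA hA, fun θ hθ => ?_⟩, fun hB => ?_,
    fun hC => ⟨hp.existsUnique_thetaC hC, fun θ hθ => ?_⟩, fun V hV => ?_⟩
  · have hg := hp.isBestResponse_valueA hθ
    obtain ⟨hex, hopt⟩ := hg.multiplier (ℱ := ℱ) hp hmeas hζ fun y hy => FundModel.valueA_eq θ hy
    refine ⟨hex, fun y hy => ⟨(hopt y hy).1, fun V hV => ?_⟩⟩
    exact hp.hasMoments_valueA hW hθ hy.1 ((hopt y hy).2 V hV)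
  · have hg := hp.isBestResponse_valueB hB
    obtain ⟨hex, hopt⟩ := hg.multiplier (ℱ := ℱ) hp hmeas hζ fun y hy => FundModel.valueB_eq hy
    refine ⟨hex, fun y hy => ⟨(hopt y hy).1, fun V hV => ?_⟩⟩
    exact hp.hasMoments_valueB hW hB hy.1 ((hopt y hy).2 V hV)
  · have hg := hp.isBestResponse_valueC hC hθ
    obtain ⟨hex, hopt⟩ := hg.multiplier (ℱ := ℱ) hp hmeas hζ fun y hy => FundModel.valueC_eq θ hy
    refine ⟨hex, fun y hy => ⟨(hopt y hy).1, fun V hV => ?_⟩⟩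
    exact hp.hasMoments_valueC hW hC hθ hy.1 ((hopt y hy).2 V hV)
  · obtain ⟨g, s, hg⟩ := hp.exists_isBestResponse
    obtain ⟨y, ⟨hy, hbudget⟩, -⟩ := hg.existsUnique_multiplier hζ hp.v₀_pos
    have hVg := hV.ae_eq_of_isBestResponse hg hmeas hζ hy hbudget
    have hL2 : MemLp V 2 Q := (hg.memLp hζ hy).ae_eq hVg.symm
    have hpos := FundModel.variance_pos_of_isBestResponse hg hζ hy hVg hL2
    exact ⟨hpos, FundModel.sharpeRatio_eq hp.v₀_pos hL2⟩
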